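/- Let $(S,d)$ be a compact metric space, $\mu$ a Borel measure on $S$, and let $1<p,q<\infty$ with $\frac1p+\frac1q=1$. Put $X=L^p(S,\mu)$, with dual $X^*\cong L^q(S,\mu)$, pairing $\langle u,x\rangle=\int_S u\,x\,d\mu$ and dual norm $\|\cdot\|_*$, and let $\mathcal X=\{x\in X: x\ge 0 \text{ a.e.},\ \|x\|_1=1\}$. For $s\in S$ and $\delta>0$ let $\mathcal B(s,\delta)$ be the set of $x\in\mathcal X$ that vanish a.e. outside the open ball $B(s,\delta)$. Let $\chi:[0,\infty)\to[0,\infty]$ be non-decreasing with $\lim_{r\to0}\chi(r)=\chi(0)=0$, and let $u_1,u_2,\dots:S\to\mathbb R$ be reward functions in $L^q(S,\mu)$ with $|u_t(s)-u_t(s')|\le\chi(d(s,s'))$ for all $t\geq 1$ and all $s,s'\in S$. Let $\gamma:[0,\infty)\to[0,\infty]$ be convex and lower semicontinuous with $\gamma(0)=0$ and $\gamma(r)>0$ for $r>0$. Let $h:X\to(-\infty,\infty]$ be a proper convex lower semicontinuous function with $\{h<\infty\}=\mathcal X$ that is uniformly essentially strongly convex with modulus $\gamma$, i.e.: (i) $h$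 is strictly convex on every convex subset of $\operatorname{dom}\partial h=\{x:\partial h(x)\ne\emptyset\}$, where $\partial h(x)=\{\xi\in X^*: h(y)\ge h(x)+\langle \xi,y-x\rangle\ \forall y\in X\}$; (ii) $(\partial h)^{-1}$ is locally bounded on its domain; (iii) for every $x_0\in\operatorname{dom}\partial h$ there is $\xi_0\in X^*$ with $h(x)\ge h(x_0)+\langle\xi_0,x-x_0\rangle+\gamma(\|x-x_0\|)$ for all $x\in X$. Let $(\eta_t)_{t\ge1}$ be a positive non-increasing sequence, $\eta_0:=\eta_1$. Let $h^*(\xi)=\sup_{x\in X}\langle \xi,x\rangle-h(x)$, and write $x=Dh^*(\xi)$ if $h^*$ is finite near $\xi$ and Fréchet differentiable at $\xi$ with derivative $\zeta\mapsto\langle\zeta,x\rangle$. Then the Dual Averaging strategy $$x_{t+1}=Dh^*\Bigl(\eta_t\sum_{\tau=1}^t u_\tau\Bigr),\qquad t\ge0,$$ is well defined (the gradients exist, as elements of $X$), and for every positive sequence $(\vartheta_t)_{t\ge1}$ and every $t\ge1$ the worst-case regret $\mathcal R_t:=\sup_{x\in\mathcal X}\bigl(\sum_{\tau=1}^t\langle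 u_\tau,x\rangle-\sum_{\tau=1}^t\langle u_\tau,x_\tau\rangle\bigr)$ satisfies $$\mathcal R_t\le\frac{\sup_{s\in S}\inf_{x\in\mathcal B(s,\vartheta_t)}h(x)-\underline h}{\eta_t}+t\,\chi(\vartheta_t)+\sum_{\tau=1}^t\|u_\tau\|_*\,\tilde\gamma^{-1}\Bigl(\frac{\eta_{\tau-1}}2\|u_\tau\|_*\Bigr),$$ where $\underline h=\inf_{x\in\mathcal X}h(x)$, $\tilde\gamma(r)=\gamma(r)/r$ for $r>0$ and $\tilde\gamma(0)=0$, $\tilde\gamma^{-1}(s)=\sup\{r\ge0:\tilde\gamma(r)\le s\}\in[0,\infty]$ (the usual inverse where $\tilde\gamma$ is strictly increasing), $0\cdot\infty=0$, and the infimum over an empty set is $+\infty$; both sides are understood in $(-\infty,\infty]$. -/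

import Mathlib

open MeasureTheory Filter Topology
open scoped NNReal ENNReal

noncomputable section

namespace DualAvg

/-! ### Moduli -/

/-- The class `Γ_U`: convex lower semicontinuous `γ : [0,∞) → [0,∞]` with `γ 0 = 0` and
`γ r > 0` for `r > 0`. -/
structure IsGammaU (γ : ℝ≥0 → ℝ≥0∞) : Prop where
  convex : ConvexOn ℝ≥0 Set.univ γ
  lsc : LowerSemicontinuous γ
  zero : γ 0 = 0
  pos : ∀ r : ℝ≥0, 0 < r → 0 < γ r

/-- `γ̃ r = γ r / r` (with value `0` at `r = 0` when `γ 0 = 0`). -/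
def gammaTilde (γ : ℝ≥0 → ℝ≥0∞) (r : ℝ≥0) : ℝ≥0∞ := γ r / r

/-- The inverse of `γ̃` as the right inverse `s ↦ sup {r | γ̃ r ≤ s}` with values in `[0,∞]`. It is
the usual inverse wherever `γ̃` is strictly increasing and attains the value `s`. -/
def gammaTildeInv (γ : ℝ≥0 → ℝ≥0∞) (s : ℝ≥0∞) : ℝ≥0∞ :=
  ⨆ (r : ℝ≥0) (_ : gammaTilde γ r ≤ s), (r : ℝ≥0∞)

/-- The class `𝒵` of moduli of continuity: non-decreasing `χ : [0,∞) → [0,∞]` with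
`χ r → χ 0 = 0` as `r → 0`. -/
structure IsModulus (χ : ℝ≥0 → ℝ≥0∞) : Prop where
  mono : Monotone χ
  zero : χ 0 = 0
  tendsto : Tendsto χ (𝓝 0) (𝓝 0)

/-! ### Convex analysis of extended real valued functions on a normed space -/

section Banach

variable {X : Type*} [NormedAddCommGroup X] [NormedSpace ℝ X]

/-- The effective domain. -/
def effDom (f : X → EReal) : Set X := {x | f x < ⊤}

/-- Proper: never `-∞`, and not identically `+∞`. -/
def IsProper (f : X → EReal) : Prop := (∀ x, ⊥ < f x) ∧ (effDom f).Nonempty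

/-- Convexity (used for functions that never take the value `-∞`). -/
def IsConvex (f : X → EReal) : Prop :=
  ∀ x y : X, ∀ a b : ℝ, 0 < a → 0 < b → a + b = 1 →
    f (a • x + b • y) ≤ (a : EReal) * f x + (b : EReal) * f y

/-- Strict convexity on a set. -/
def IsStrictlyConvexOn (f : X → EReal) (K : Set X) : Prop :=
  ∀ x ∈ K, ∀ y ∈ K, x ≠ y → ∀ a b : ℝ, 0 < a → 0 < b → a + b = 1 →
    f (a • x + b • y) < (a : EReal) * f x + (b : EReal) * f y

/-- The Legendre-Fenchel conjugate on the dual space. -/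
def conj (f : X → EReal) (ξ : StrongDual ℝ X) : EReal :=
  ⨆ x : X, ((ξ x : ℝ) : EReal) - f x

/-- The subdifferential. -/
def subdiff (f : X → EReal) (x : X) : Set (StrongDual ℝ X) :=
  {ξ | ∀ y : X, f x + ((ξ (y - x) : ℝ) : EReal) ≤ f y}

/-- The domain of the subdifferential. -/
def domSubdiff (f : X → EReal) : Set X := {x | (subdiff f x).Nonempty}

/-- `(∂f)⁻¹` is locally bounded on its domain. -/
def InvSubdiffLocallyBounded (f : X → EReal) : Prop :=
  ∀ ξ : StrongDual ℝ X, (∃ x, ξ ∈ subdiff f x) →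
    ∃ V ∈ 𝓝 ξ, Bornology.IsBounded {x : X | ∃ ζ ∈ V, ζ ∈ subdiff f x}

/-- The growth inequality `f x ≥ f x₀ + ⟨x - x₀, ξ₀⟩ + γ ‖x - x₀‖` for all `x`. -/
def HasGrowth (f : X → EReal) (γ : ℝ≥0 → ℝ≥0∞) (x₀ : X) (ξ₀ : StrongDual ℝ X) : Prop :=
  ∀ x : X, f x₀ + ((ξ₀ (x - x₀) : ℝ) : EReal) + ((γ ‖x - x₀‖₊ : ℝ≥0∞) : EReal) ≤ f x

/-- Essential strong convexity. -/
structure IsEssStronglyConvex (f : X → EReal) : Prop where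
  proper : IsProper f
  convex : IsConvex f
  lsc : LowerSemicontinuous f
  strict : ∀ K : Set X, Convex ℝ K → K ⊆ domSubdiff f → IsStrictlyConvexOn f K
  locallyBounded : InvSubdiffLocallyBounded f
  growth : ∀ x₀ ∈ domSubdiff f, ∃ (ξ₀ : StrongDual ℝ X) (γ : ℝ≥0 → ℝ≥0∞),
    IsGammaU γ ∧ HasGrowth f γ x₀ ξ₀

/-- Uniform essential strong convexity with modulus `γ`: the growth inequality holds with a `γ`
that does not depend on the base point. -/
structure IsUnifEssStronglyConvex (f : X → EReal) (γ : ℝ≥0 → ℝ≥0∞) : Prop where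
  ess : IsEssStronglyConvex f
  gammaU : IsGammaU γ
  growth_unif : ∀ x₀ ∈ domSubdiff f, ∃ ξ₀ : StrongDual ℝ X, HasGrowth f γ x₀ ξ₀

/-- `h` is a uniformly essentially strongly convex regularizer on `C` with modulus `γ`. -/
def IsUnifRegularizer (h : X → EReal) (C : Set X) (γ : ℝ≥0 → ℝ≥0∞) : Prop :=
  IsUnifEssStronglyConvex h γ ∧ effDom h = C

/-- `x = DF(ξ)`: the function `F` on the dual space is finite near `ξ` and Fréchet differentiable
at `ξ`, its derivative there being the evaluation `ζ ↦ ζ x` at the point `x` of `X`. -/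
def IsFrechetGradient (F : StrongDual ℝ X → EReal) (ξ : StrongDual ℝ X) (x : X) : Prop :=
  (∀ᶠ ζ in 𝓝 ξ, F ζ ≠ ⊥ ∧ F ζ ≠ ⊤) ∧
    HasFDerivAt (fun ζ => (F ζ).toReal) (NormedSpace.inclusionInDoubleDual ℝ X x) ξ

/-- The plays of Dual Averaging: `x (t+1) = Dh*(η t • (u 1 + ⋯ + u t))` for all `t ≥ 0`
(so `x 1 = Dh*(0)`; the entry `x 0` plays no role). -/
def IsDualAveraging (h : X → EReal) (η : ℕ → ℝ) (u : ℕ → StrongDual ℝ X) (x : ℕ → X) : Prop :=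
  ∀ t : ℕ, IsFrechetGradient (conj h) (η t • ∑ τ ∈ Finset.Icc 1 t, u τ) (x (t + 1))

/-- The regret `R_t(y)` of the plays `x` against the fixed decision `y`. -/
def regret (u : ℕ → StrongDual ℝ X) (x : ℕ → X) (t : ℕ) (y : X) : ℝ :=
  ∑ τ ∈ Finset.Icc 1 t, u τ y - ∑ τ ∈ Finset.Icc 1 t, u τ (x τ)

/-- The worst-case regret over the decision set `C`. -/
def worstRegret (C : Set X) (u : ℕ → StrongDual ℝ X) (x : ℕ → X) (t : ℕ) : EReal :=
  ⨆ y ∈ C, ((regret u x t y : ℝ) : EReal)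

end Banach

/-! ### Probability densities on a metric space -/

section Densities

variable {S : Type*} [MeasurableSpace S]

/-- The functional `x ↦ ∫ u x dμ` on `L^p` defined by `u ∈ L^q`. -/
def rewardFunctional {μ : Measure S} {p q : ℝ≥0∞} [Fact (1 ≤ p)] [Fact (1 ≤ q)]
    [ENNReal.HolderConjugate q p] (u : S → ℝ) (hu : MemLp u q μ) :
    StrongDual ℝ (Lp ℝ p μ) :=
  (ContinuousLinearMap.mul ℝ ℝ).lpPairing μ q p (hu.toLp u)

/-- The set of probability densities in `L^p(S, μ)`. -/
def densities (μ : Measure S) (p : ℝ≥0∞) : Set (Lp ℝ p μ) :=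
  {x | (∀ᵐ s ∂μ, 0 ≤ x s) ∧ eLpNorm x 1 μ = 1}

/-- The probability densities in `L^p(S, μ)` that are supported in (i.e. vanish a.e. outside) the
open ball of radius `δ` around `s`. -/
def densitiesNear [MetricSpace S] (μ : Measure S) (p : ℝ≥0∞) (s : S) (δ : ℝ) :
    Set (Lp ℝ p μ) :=
  {x | x ∈ densities μ p ∧ ∀ᵐ s' ∂μ, s' ∉ Metric.ball s δ → x s' = 0}

end Densities

end DualAvg

end

/-! The growth hypothesis offers only one good subgradient at each point of `domSubdiff h`, whereas
Dual Averaging needs growth along the prescribed slope `η t • ∑ u τ`, and needs a minimizer of `h -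
ξ` for every `ξ`. Both follow once `h` is uniformly convex on its whole domain
(`HasUnifGrowth.isUnifConvexOn`). If the intermediate point `m` of a segment is subdifferentiable,
the growth inequality at `m` tested at one end and the subgradient inequality tested at the other
add up so that the slope cancels. A general `m` is approached by points `(1 - ε) • m + ε • d` of
subdifferentiability, with `d` bounded and of bounded cost (`exists_subgradient_in_copy`: Ekeland
plus Hahn-Banach). This approximation needs room in the domain. The densities may have empty
interior, but Baire's theorem in `L¹ ∩ Lᵖ` bounds `h` near some density, and positive and negative
parts then realize every small multiple of a difference of densities inside a sublevel set
(`hasPerturbations_densities`). Uniform convexity makes `h` superlinear and minimizing sequences of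
`h - ξ` Cauchy. The minimizers exist, obey the growth inequality with slope `ξ`, and are the Fréchet
gradients of `conj h`. The regret bound is a be-the-leader induction against plays that already know
the next reward, with the price of that knowledge bounded through `γ`. The worst density is then
compared with one concentrated near a maximizer of the cumulative reward, at a cost of `χ (ϑ t)` per
round. -/

namespace DualAvg

/-! ### Ekeland's principle and subgradients by separation -/

section Variational

/-- Lower semicontinuity of the extension of `H : K → ℝ` by `+∞` outside of `K`, in sequential
form. -/
def IsSeqLscOn {X : Type*} [NormedAddCommGroup X] (K : Set X) (H : X → ℝ) : Prop :=
  ∀ (v : ℕ → X) (x : X) (c : ℝ), (∀ n, v n ∈ K) → Tendsto v atTop (𝓝 x) →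
    (∀ ε > 0, ∀ᶠ n in atTop, H (v n) ≤ c + ε) → x ∈ K ∧ H x ≤ c

/-- Ekeland's variational principle. -/
theorem exists_ekeland_point {X : Type*} [NormedAddCommGroup X] [CompleteSpace X] {A : Set X} {H : X → ℝ} (hA : A.Nonempty)
    (hl : IsSeqLscOn A H) {b : ℝ} (hb : ∀ x ∈ A, b ≤ H x) :
    ∃ x ∈ A, ∀ y ∈ A, H x - ‖y - x‖ ≤ H y := by
  classical
  let T : X → Set X := fun x => {y | y ∈ A ∧ H y + ‖y - x‖ ≤ H x}
  have hself : ∀ x ∈ A, x ∈ T x := fun x hx => ⟨hx, by simp⟩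
  have hbdd : ∀ x, BddBelow (H '' T x) := fun x => ⟨b, by
    rintro _ ⟨y, hy, rfl⟩; exact hb y hy.1⟩
  have step : ∀ (n : ℕ) (x : X), x ∈ A → ∃ y ∈ T x, ∀ z ∈ T x, H y ≤ H z + (1 / 2 : ℝ) ^ n := by
    intro n x hx
    obtain ⟨_, ⟨y, hy, rfl⟩, hlt⟩ := exists_lt_of_csInf_lt (Set.Nonempty.image H ⟨x, hself x hx⟩)
      (lt_add_of_pos_right (sInf (H '' T x)) (by positivity : (0 : ℝ) < (1 / 2) ^ n))
    refine ⟨y, hy, fun z hz => ?_⟩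
    have := csInf_le (hbdd x) ⟨z, hz, rfl⟩
    linarith
  choose! f hfT hfz using step
  obtain ⟨x0, hx0⟩ := hA
  let v : ℕ → X := fun n => Nat.rec x0 (fun k x => f k x) n
  have hv : ∀ n, v (n + 1) = f n (v n) := fun n => rfl
  have hvA : ∀ n, v n ∈ A := by
    intro n
    induction n with
    | zero => exact hx0
    | succ n ih => rw [hv]; exact (hfT n _ ih).1
  have hTmono : ∀ x y z, y ∈ T x → z ∈ T y → z ∈ T x := by
    rintro x y z ⟨_, h1⟩ ⟨hz, h2⟩
    refine ⟨hz, ?_⟩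
    have := norm_sub_le_norm_sub_add_norm_sub z y x
    linarith
  have hvT : ∀ n k, v (n + k) ∈ T (v n) := by
    intro n k
    induction k with
    | zero => exact hself _ (hvA n)
    | succ k ih => exact hTmono _ _ _ ih (hfT _ _ (hvA (n + k)))
  -- By transitivity `y` also lies in `T (v n)`, where `v (n + 1)` minimizes `H` up to `2⁻ⁿ`; the
  -- decrease of `H` that pays for the distance is at most that.
  have hsmall : ∀ n, ∀ y ∈ T (v (n + 1)), ‖y - v (n + 1)‖ ≤ (1 / 2 : ℝ) ^ n := by
    intro n y hy
    have h1 := hfz n (v n) (hvA n) y (hTmono _ _ _ (hfT n _ (hvA n)) hy)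
    have h2 := hy.2
    rw [hv] at h2 ⊢
    linarith
  have hcauchy : CauchySeq v := by
    rw [Metric.cauchySeq_iff']
    intro ε hε
    obtain ⟨n, hn⟩ := exists_pow_lt_of_lt_one hε (by norm_num : (1 / 2 : ℝ) < 1)
    refine ⟨n + 1, fun m hm => ?_⟩
    obtain ⟨k, rfl⟩ := Nat.exists_eq_add_of_le hm
    rw [dist_eq_norm]
    exact (hsmall n _ (hvT (n + 1) k)).trans_lt hn
  obtain ⟨x, hx⟩ := cauchySeq_tendsto_of_complete hcauchy
  have hxT : ∀ n, x ∈ T (v n) := by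
    intro n
    have hlim : Tendsto (fun k => v (n + k)) atTop (𝓝 x) := by
      simpa [add_comm] using (tendsto_add_atTop_iff_nat n).2 hx
    have hn : Tendsto (fun k => ‖v (n + k) - v n‖) atTop (𝓝 ‖x - v n‖) :=
      (hlim.sub_const _).norm
    have := hl (fun k => v (n + k)) x (H (v n) - ‖x - v n‖) (fun k => hvA _) hlim ?_
    · exact ⟨this.1, by linarith [this.2]⟩
    · intro ε hε
      filter_upwards [hn.eventually (lt_mem_nhds (sub_lt_self _ hε))] with k hk
      have := (hvT n k).2
      linarith
  refine ⟨x, (hxT 0).1, fun y hy => ?_⟩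
  by_contra! hlt
  have hyT : y ∈ T x := ⟨hy, by linarith⟩
  have hy0 : Tendsto (fun n => ‖y - v (n + 1)‖) atTop (𝓝 0) := by
    refine squeeze_zero (fun _ => norm_nonneg _)
      (fun n => hsmall n y (hTmono _ _ _ (hxT (n + 1)) hyT))
      (tendsto_pow_atTop_nhds_zero_of_lt_one (by norm_num) (by norm_num))
  have hy1 : Tendsto (fun n => ‖y - v (n + 1)‖) atTop (𝓝 ‖y - x‖) :=
    (tendsto_const_nhds.sub ((tendsto_add_atTop_iff_nat 1).2 hx)).norm
  have h0 := tendsto_nhds_unique hy0 hy1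
  have : y = x := by rw [← sub_eq_zero, ← norm_eq_zero, h0]
  subst this
  simp at hlt

variable {X : Type*} [NormedAddCommGroup X] [NormedSpace ℝ X]

/-- A convex function with bounded downward slope at a point is subdifferentiable there. -/
theorem exists_subgradient_of_slope_bound {K : Set X} {H : X → ℝ} (hconv : ConvexOn ℝ K H)
    {m : X} (hm : m ∈ K) {L : ℝ} (hL : ∀ z ∈ K, H m - L * ‖z - m‖ ≤ H z) (hL0 : 0 ≤ L) :
    ∃ ξ : StrongDual ℝ X, ∀ z ∈ K, H m + ξ (z - m) ≤ H z := by
  -- The open region below the concave cone with apex `(m, H m)` misses the epigraph of `H`; a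
  -- separating hyperplane passes through the apex and is the graph of the subgradient.
  let s : Set (X × ℝ) := {w | w.2 < H m - L * ‖w.1 - m‖}
  let t : Set (X × ℝ) := {w | w.1 ∈ K ∧ H w.1 ≤ w.2}
  have hs : IsOpen s := isOpen_lt continuous_snd (by fun_prop)
  have hsc : Convex ℝ s := by
    rintro ⟨x, r⟩ hx ⟨y, r'⟩ hy a b ha hb hab
    simp only [s, Set.mem_ofPred_eq, Prod.smul_mk, Prod.mk_add_mk, smul_eq_mul] at hx hy ⊢
    have h1 : ‖a • x + b • y - m‖ ≤ a * ‖x - m‖ + b * ‖y - m‖ := by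
      have : a • x + b • y - m = a • (x - m) + b • (y - m) := by
        have : m = (a + b) • m := by rw [hab, one_smul]
        nth_rewrite 1 [this]; module
      rw [this]
      refine (norm_add_le _ _).trans (le_of_eq ?_)
      rw [norm_smul, norm_smul, Real.norm_of_nonneg ha, Real.norm_of_nonneg hb]
    have h2 : a * r + b * r' < a * (H m - L * ‖x - m‖) + b * (H m - L * ‖y - m‖) := by
      rcases ha.eq_or_lt with rfl | ha'
      · have : b = 1 := by linarith
        subst this; simpa using hy
      · have := mul_lt_mul_of_pos_left hx ha'
        have := mul_le_mul_of_nonneg_left hy.le hb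
        linarith
    have h3 : a * (H m - L * ‖x - m‖) + b * (H m - L * ‖y - m‖) =
        H m - L * (a * ‖x - m‖ + b * ‖y - m‖) := by
      linear_combination H m * hab
    have := mul_le_mul_of_nonneg_left h1 hL0
    linarith
  have htc : Convex ℝ t := hconv.convex_epigraph
  have hdisj : Disjoint s t := by
    rw [Set.disjoint_left]
    rintro ⟨x, r⟩ hx ⟨hxK, hxr⟩
    simp only [s, Set.mem_ofPred_eq] at hx hxr
    linarith [hL x hxK]
  obtain ⟨f, u, hfs, hft⟩ := geometric_hahn_banach_open hsc hs htc hdisj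
  have hf : ∀ z r, f (z, r) = f (z, 0) + r * f (0, 1) := by
    intro z r
    have : ((z, r) : X × ℝ) = (z, 0) + r • (0, 1) := by simp
    rw [this, map_add, map_smul, smul_eq_mul]
  have hmt : u ≤ f (m, H m) := hft _ ⟨hm, le_rfl⟩
  have hms : ∀ ε > 0, f (m, H m - ε) < u := fun ε hε => hfs _ (by simp [s, hε])
  -- The hyperplane is not vertical: it separates `(m, H m - 1)` strictly from `(m, H m)`.
  have hc : 0 < f (0, 1) := by
    have := hms 1 one_pos
    rw [hf] at hmt this
    nlinarith
  have hu : f (m, H m) ≤ u := by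
    by_contra! hlt
    have := hms ((f (m, H m) - u) / f (0, 1)) (by apply div_pos <;> linarith)
    rw [hf, sub_mul, div_mul_cancel₀ _ hc.ne'] at this
    have h2 := hf m (H m)
    linarith
  refine ⟨-(f (0, 1))⁻¹ • (f.comp (ContinuousLinearMap.inl ℝ X ℝ)), fun z hz => ?_⟩
  have h1 := hu.trans (hft (z, H z) ⟨hz, le_rfl⟩)
  rw [hf, hf z] at h1
  have h2 : f (z - m, 0) = f (z, 0) - f (m, 0) := by rw [← map_sub]; simp
  simp only [smul_apply, ContinuousLinearMap.comp_apply,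
    ContinuousLinearMap.inl_apply, smul_eq_mul, h2]
  have h3 : ∀ r, (f (0, 1))⁻¹ * (r * f (0, 1)) = r := fun r => by field_simp
  have h4 := mul_le_mul_of_nonneg_left h1 (inv_nonneg.2 hc.le)
  rw [mul_add, mul_add, h3, h3] at h4
  linarith

end Variational

/-! ### From growth at subdifferentiable points to uniform convexity -/

section UniformConvexity

variable {X : Type*} [NormedAddCommGroup X] [NormedSpace ℝ X] {K : Set X} {H : X → ℝ}

theorem IsSeqLscOn.exists_ball {X : Type*} [NormedAddCommGroup X] {K : Set X} {H : X → ℝ}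
    (hl : IsSeqLscOn K H) {m : X} {δ : ℝ} (hδ : 0 < δ) :
    ∃ ρ > 0, ∀ z ∈ K, ‖z - m‖ < ρ → H m - δ < H z := by
  by_contra! hcon
  choose v hvK hv hHv using fun n : ℕ => hcon (1 / ((n : ℝ) + 1)) (by positivity)
  have hlim : Tendsto v atTop (𝓝 m) := by
    rw [tendsto_iff_norm_sub_tendsto_zero]
    exact squeeze_zero (fun _ => norm_nonneg _) (fun n => (hv n).le)
      tendsto_one_div_add_atTop_nhds_zero_nat
  have := (hl v m (H m - δ) hvK hlim
    (fun ε hε => Eventually.of_forall fun n => by linarith [hHv n])).2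
  linarith

/-- `(K - K)`-perturbations of size at most `r` can be realized inside of a bounded part of a
sublevel set. -/
def HasPerturbations (K : Set X) (H : X → ℝ) (M R r : ℝ) : Prop :=
  ∀ x ∈ K, ∀ y ∈ K, ∀ t : ℝ, 0 ≤ t → t * ‖x - y‖ ≤ r →
    ∃ d ∈ K, H d ≤ M ∧ ‖d‖ ≤ R ∧ d + t • (x - y) ∈ K ∧ H (d + t • (x - y)) ≤ M

/-- The points of a shrunken copy of a sublevel set at which the function has a small slope are
points of subdifferentiability: the qualification condition `HasPerturbations` removes the
contribution of the normal cone of the copy. -/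
theorem exists_subgradient_in_copy [CompleteSpace X] (hconv : ConvexOn ℝ K H)
    (hl : IsSeqLscOn K H) {M R r : ℝ} (hr : 0 < r) (hQ : HasPerturbations K H M R r)
    {m : X} (hm : m ∈ K) {ε b : ℝ} (hε : 0 < ε) (hε1 : ε ≤ 1)
    (hb : ∀ d ∈ K, ‖d‖ ≤ R → (1 - ε) • m + ε • d ∈ K → b ≤ H ((1 - ε) • m + ε • d)) :
    ∃ d ∈ K, H d ≤ M ∧ ‖d‖ ≤ R ∧ ∃ ξ : StrongDual ℝ X, ∀ z ∈ K,
      H ((1 - ε) • m + ε • d) + ξ (z - ((1 - ε) • m + ε • d)) ≤ H z := by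
  let D : Set X := {d | d ∈ K ∧ H d ≤ M ∧ ‖d‖ ≤ R}
  let j : X → X := fun d => (1 - ε) • m + ε • d
  have hjK : ∀ d ∈ K, j d ∈ K := fun d hd =>
    hconv.1 hm hd (by linarith) hε.le (by ring)
  have hjH : ∀ d ∈ K, H (j d) ≤ (1 - ε) * H m + ε * H d := fun d hd => by
    simpa using hconv.2 hm hd (by linarith : (0 : ℝ) ≤ 1 - ε) hε.le (by ring)
  have hDconv : ∀ d ∈ D, ∀ d' ∈ D, ∀ θ : ℝ, 0 ≤ θ → θ ≤ 1 → θ • d + (1 - θ) • d' ∈ D := by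
    rintro d ⟨h1, h2, h3⟩ d' ⟨h1', h2', h3'⟩ θ hθ hθ1
    refine ⟨hconv.1 h1 h1' hθ (by linarith) (by ring), ?_, ?_⟩
    · have := hconv.2 h1 h1' hθ (by linarith : (0 : ℝ) ≤ 1 - θ) (by ring)
      simp only [smul_eq_mul] at this
      nlinarith
    · refine (norm_add_le _ _).trans ?_
      rw [norm_smul, norm_smul, Real.norm_of_nonneg hθ, Real.norm_of_nonneg (sub_nonneg.2 hθ1)]
      nlinarith
  obtain ⟨d₀, hd₀K, hd₀M, hd₀R, -⟩ := hQ m hm m hm 0 le_rfl (by simpa using hr.le)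
  have hR : 0 ≤ R := (norm_nonneg _).trans hd₀R
  have hlA : IsSeqLscOn (j '' D) H := by
    intro v x c hv hvx hc
    choose d hdD hdv using hv
    have hx := (hl v x c (fun n => by rw [← hdv]; exact hjK _ (hdD n).1) hvx hc).2
    have hd : ∀ n, d n = ε⁻¹ • (v n - (1 - ε) • m) := by
      intro n
      rw [← hdv]
      simp only [j, add_sub_cancel_left, smul_smul, inv_mul_cancel₀ hε.ne', one_smul]
    have hlim : Tendsto d atTop (𝓝 (ε⁻¹ • (x - (1 - ε) • m))) := by
      rw [show d = fun n => ε⁻¹ • (v n - (1 - ε) • m) from funext hd]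
      exact (hvx.sub_const _).const_smul _
    have hcl := hl d _ M (fun n => (hdD n).1) hlim
      (fun e he => Eventually.of_forall fun n => by linarith [(hdD n).2.1])
    refine ⟨⟨_, ⟨hcl.1, hcl.2, le_of_tendsto hlim.norm (Eventually.of_forall
      fun n => (hdD n).2.2)⟩, ?_⟩, hx⟩
    simp only [j, smul_smul, mul_inv_cancel₀ hε.ne', one_smul, add_sub_cancel]
  have hDne : D.Nonempty := ⟨d₀, hd₀K, hd₀M, hd₀R⟩
  obtain ⟨_, ⟨d', hd', rfl⟩, hek⟩ := exists_ekeland_point (b := b) (hDne.image j) hlA (by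
      rintro _ ⟨d, hd, rfl⟩
      exact hb d hd.1 hd.2.2 (hjK d hd.1))
  refine ⟨d', hd'.1, hd'.2.1, hd'.2.2, ?_⟩
  change ∃ ξ : StrongDual ℝ X, ∀ z ∈ K, H (j d') + ξ (z - j d') ≤ H z
  have hM' : ∀ d ∈ K, H d ≤ M → H (j d) ≤ (1 - ε) * H m + ε * M := fun d hd hdM =>
    (hjH d hd).trans (by nlinarith)
  set M' := (1 - ε) * H m + ε * M
  have hL0 : 0 ≤ M' + 2 * R - H (j d') := by linarith [hM' d' hd'.1 hd'.2.1]
  -- Ekeland bounds the slope at `j d'` only inside the copy `j '' D`. For arbitrary `z ∈ K`, a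
  -- perturbation of size `r` pointing away from `z` is averaged with `z` so as to land back in the
  -- copy; `L` is the resulting gap divided by `ε * r`.
  refine exists_subgradient_of_slope_bound hconv (hjK _ hd'.1)
    (L := (M' + 2 * R - H (j d')) / (ε * r)) (fun z hz => ?_) (by positivity)
  rcases eq_or_ne z (j d') with rfl | hne
  · simp
  have hn : 0 < ‖z - j d'‖ := norm_pos_iff.2 (sub_ne_zero.2 hne)
  set t := r / ‖z - j d'‖ with ht
  have ht0 : 0 < t := by positivity
  obtain ⟨d, hdK, hdM, hdR, hdK', hdM'⟩ := hQ (j d') (hjK _ hd'.1) z hz t ht0.le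
    (by rw [norm_sub_rev, ht, div_mul_cancel₀ _ hn.ne'])
  -- Chosen so that `θ = (1 - θ) * (ε * t)`: the pull towards `z` then cancels the push away from
  -- it, and the average is a point of the copy.
  set θ := ε * t / (1 + ε * t) with hθ
  have hpos : 0 < 1 + ε * t := by positivity
  have hθ0 : 0 < θ := by positivity
  have hθ' : 1 - θ = 1 / (1 + ε * t) := by rw [hθ]; field_simp; ring
  have hθ1 : 0 < 1 - θ := by rw [hθ']; positivity
  have hθt : θ = (1 - θ) * (ε * t) := by rw [hθ', hθ]; ring
  have hp : j (θ • d' + (1 - θ) • d) = θ • z + (1 - θ) • j (d + t • (j d' - z)) := by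
    have h1 : θ • z = θ • j d' - θ • (j d' - z) := by module
    have h2 : θ • (j d' - z) = ((1 - θ) * (ε * t)) • (j d' - z) := by rw [← hθt]
    rw [h1, h2]
    simp only [j]
    module
  have h1 := hek _ ⟨_, hDconv d' hd' d ⟨hdK, hdM, hdR⟩ θ hθ0.le (by linarith), rfl⟩
  have h2 : ‖j (θ • d' + (1 - θ) • d) - j d'‖ ≤ (1 - θ) * (2 * R) := by
    have : j (θ • d' + (1 - θ) • d) - j d' = (ε * (1 - θ)) • (d - d') := by
      simp only [j]; module
    rw [this, norm_smul, Real.norm_of_nonneg (by positivity)]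
    have h3 : ‖d - d'‖ ≤ 2 * R := (norm_sub_le _ _).trans (by linarith [hd'.2.2])
    calc ε * (1 - θ) * ‖d - d'‖ ≤ 1 * (1 - θ) * (2 * R) := by gcongr
      _ = _ := by ring
  have h3 : H (j (θ • d' + (1 - θ) • d)) ≤ θ * H z + (1 - θ) * M' := by
    rw [hp]
    refine (hconv.2 hz (hjK _ hdK') hθ0.le hθ1.le (by ring)).trans ?_
    simp only [smul_eq_mul]
    linarith [mul_le_mul_of_nonneg_left (hM' _ hdK' hdM') hθ1.le]
  have h4 : (1 - θ) * (ε * t * (H (j d') - H z)) ≤ (1 - θ) * (M' + 2 * R - H (j d')) := by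
    have : (1 - θ) * (ε * t * (H (j d') - H z)) = θ * (H (j d') - H z) := by
      rw [← mul_assoc, ← hθt]
    rw [this]; linarith
  have h5 := le_of_mul_le_mul_left h4 hθ1
  have h6 : (M' + 2 * R - H (j d')) / (ε * r) * ‖z - j d'‖ =
      (M' + 2 * R - H (j d')) / (ε * t) := by
    rw [ht]; field_simp
  rw [h6]
  have h7 : H (j d') - H z ≤ (M' + 2 * R - H (j d')) / (ε * t) := by
    rw [le_div_iff₀ (by positivity)]; linarith
  linarith

/-- Growth around the points of subdifferentiability. -/
def HasUnifGrowth (K : Set X) (H : X → ℝ) (γ : ℝ≥0 → ℝ≥0∞) : Prop :=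
  ∀ x₀ ∈ K, (∃ ξ : StrongDual ℝ X, ∀ z ∈ K, H x₀ + ξ (z - x₀) ≤ H z) →
    ∃ ξ₀ : StrongDual ℝ X, ∀ z ∈ K, H x₀ + ξ₀ (z - x₀) ≤ H z ∧
      γ ‖z - x₀‖₊ ≤ ENNReal.ofReal (H z - H x₀ - ξ₀ (z - x₀))

/-- Uniform convexity with modulus `γ`. -/
def IsUnifConvexOn (K : Set X) (H : X → ℝ) (γ : ℝ≥0 → ℝ≥0∞) : Prop :=
  ∀ x ∈ K, ∀ y ∈ K, ∀ l : ℝ, 0 < l → l < 1 → γ (Real.toNNReal (1 - l) * ‖y - x‖₊) ≤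
    ENNReal.ofReal (((1 - l) * H x + l * H y - H ((1 - l) • x + l • y)) / l)

/-- Growth around the points of subdifferentiability implies uniform convexity on the whole
domain. -/
theorem HasUnifGrowth.isUnifConvexOn [CompleteSpace X] {γ : ℝ≥0 → ℝ≥0∞}
    (hγ : LowerSemicontinuous γ) (hconv : ConvexOn ℝ K H)
    (hl : IsSeqLscOn K H) {M R r : ℝ} (hr : 0 < r) (hQ : HasPerturbations K H M R r)
    (hgr : HasUnifGrowth K H γ) : IsUnifConvexOn K H γ := by
  intro x hx y hy l hl0 hl1
  set m := (1 - l) • x + l • y with hm_def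
  have hm : m ∈ K := hconv.1 hx hy (by linarith) hl0.le (by ring)
  set G := (1 - l) * H x + l * H y with hG
  have hRm : Tendsto (fun ε : ℝ => ε * (R + ‖m‖)) (𝓝[>] 0) (𝓝 0) := by
    have : Tendsto (fun ε : ℝ => ε * (R + ‖m‖)) (𝓝 0) (𝓝 (0 * (R + ‖m‖))) :=
      tendsto_id.mul_const _
    rw [zero_mul] at this
    exact this.mono_left nhdsWithin_le_nhds
  -- The whole segment is contracted towards a point `d` that makes the image of `m`
  -- subdifferentiable; `δ` is the loss from mere lower semicontinuity of `H` at `m`.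
  have key : ∀ δ > 0, ∀ᶠ ε : ℝ in 𝓝[>] 0,
      γ (Real.toNNReal (1 - ε) * (Real.toNNReal (1 - l) * ‖y - x‖₊)) ≤
        ENNReal.ofReal (((1 - ε) * G + ε * M - (H m - δ)) / l) := by
    intro δ hδ
    obtain ⟨ρ, hρ, hball⟩ := hl.exists_ball (m := m) hδ
    filter_upwards [hRm.eventually (gt_mem_nhds hρ), self_mem_nhdsWithin,
      nhdsWithin_le_nhds (gt_mem_nhds one_pos)] with ε hερ hε hε1
    have hε : 0 < ε := hε
    have hε1 : ε < 1 := hε1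
    have hlow : ∀ d ∈ K, ‖d‖ ≤ R → (1 - ε) • m + ε • d ∈ K →
        H m - δ ≤ H ((1 - ε) • m + ε • d) := by
      intro d hd hdR hdm
      refine (hball _ hdm ?_).le
      have : (1 - ε) • m + ε • d - m = ε • (d - m) := by module
      rw [this, norm_smul, Real.norm_of_nonneg hε.le]
      refine lt_of_le_of_lt ?_ hερ
      gcongr
      exact (norm_sub_le _ _).trans (by linarith)
    obtain ⟨d, hdK, hdM, hdR, hsub⟩ :=
      exists_subgradient_in_copy hconv hl hr hQ hm hε hε1.le hlow
    have hcomb : ∀ z ∈ K, (1 - ε) • z + ε • d ∈ K := fun z hz =>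
      hconv.1 hz hdK (by linarith) hε.le (by ring)
    have hcombH : ∀ z ∈ K, H ((1 - ε) • z + ε • d) ≤ (1 - ε) * H z + ε * M := fun z hz => by
      have := hconv.2 hz hdK (by linarith : (0 : ℝ) ≤ 1 - ε) hε.le (by ring)
      simp only [smul_eq_mul] at this
      nlinarith
    obtain ⟨ξ, hξ⟩ := hgr _ (hcomb m hm) hsub
    have hx' := (hξ _ (hcomb x hx)).1
    have hy' := (hξ _ (hcomb y hy)).2
    have e1 : (1 - ε) • x + ε • d - ((1 - ε) • m + ε • d) = (-((1 - ε) * l)) • (y - x) := by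
      rw [hm_def]; module
    have e2 : (1 - ε) • y + ε • d - ((1 - ε) • m + ε • d) = ((1 - ε) * (1 - l)) • (y - x) := by
      rw [hm_def]; module
    rw [e1, map_smul, smul_eq_mul] at hx'
    rw [e2, map_smul, smul_eq_mul] at hy'
    have e3 : ‖((1 - ε) * (1 - l)) • (y - x)‖₊ =
        Real.toNNReal (1 - ε) * (Real.toNNReal (1 - l) * ‖y - x‖₊) := by
      rw [nnnorm_smul, ← mul_assoc]
      congr 1
      rw [← Real.toNNReal_mul (by linarith)]
      ext
      rw [coe_nnnorm, Real.norm_of_nonneg, Real.coe_toNNReal]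
      all_goals exact mul_nonneg (by linarith) (by linarith)
    rw [e3] at hy'
    refine hy'.trans (ENNReal.ofReal_le_ofReal ?_)
    rw [le_div_iff₀ hl0]
    have h1 := hcombH x hx
    have h2 := hcombH y hy
    have h3 := hlow d hdK hdR (hcomb m hm)
    set B := ξ (y - x)
    set Hm := H ((1 - ε) • m + ε • d)
    set Hx := H ((1 - ε) • x + ε • d)
    set Hy := H ((1 - ε) • y + ε • d)
    -- With weights `1 - l` and `l` the two occurrences of the unknown slope `B` cancel.
    have h4 : (1 - l) * (Hm + -((1 - ε) * l) * B) ≤ (1 - l) * ((1 - ε) * H x + ε * M) :=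
      mul_le_mul_of_nonneg_left (hx'.trans h1) (by linarith)
    have h5 : l * Hy ≤ l * ((1 - ε) * H y + ε * M) := mul_le_mul_of_nonneg_left h2 hl0.le
    rw [hG]
    linarith
  have hlimγ : Tendsto (fun ε : ℝ => Real.toNNReal (1 - ε) * (Real.toNNReal (1 - l) * ‖y - x‖₊))
      (𝓝[>] 0) (𝓝 (Real.toNNReal (1 - l) * ‖y - x‖₊)) := by
    have h1 : Continuous fun ε : ℝ =>
        Real.toNNReal (1 - ε) * (Real.toNNReal (1 - l) * ‖y - x‖₊) := by fun_prop
    have h2 := h1.tendsto 0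
    simp only [sub_zero, Real.toNNReal_one, one_mul] at h2
    exact h2.mono_left nhdsWithin_le_nhds
  have step : ∀ δ > 0, γ (Real.toNNReal (1 - l) * ‖y - x‖₊) ≤
      ENNReal.ofReal ((G - (H m - δ)) / l) := by
    intro δ hδ
    refine le_of_forall_lt fun c hc => ?_
    -- Lower semicontinuity of `γ` removes the factor `1 - ε`; working with `δ / 2` leaves the slack
    -- for a strict inequality.
    have h1 := hlimγ.eventually (hγ _ c hc)
    have h2 : Continuous fun ε : ℝ =>
        ENNReal.ofReal (((1 - ε) * G + ε * M - (H m - δ / 2)) / l) :=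
      ENNReal.continuous_ofReal.comp (by fun_prop)
    have h3 := (h2.tendsto 0).mono_left (nhdsWithin_le_nhds (s := Set.Ioi 0))
    simp only [sub_zero, one_mul, zero_mul, add_zero] at h3
    have h4 : c ≤ ENNReal.ofReal ((G - (H m - δ / 2)) / l) := by
      refine ge_of_tendsto h3 ?_
      filter_upwards [h1, key (δ / 2) (by positivity)] with ε h5 h6
      exact h5.le.trans h6
    have h0 : 0 ≤ G - H m := by
      have := hconv.2 hx hy (by linarith : (0 : ℝ) ≤ 1 - l) hl0.le (by ring)
      simp only [smul_eq_mul] at this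
      linarith
    refine h4.trans_lt ((ENNReal.ofReal_lt_ofReal_iff ?_).2 ?_)
    · apply div_pos _ hl0; linarith
    · apply div_lt_div_of_pos_right _ hl0; linarith
  have hcont : Continuous fun δ : ℝ => ENNReal.ofReal ((G - (H m - δ)) / l) :=
      ENNReal.continuous_ofReal.comp (by fun_prop)
  have h3 := (hcont.tendsto 0).mono_left (nhdsWithin_le_nhds (s := Set.Ioi 0))
  simp only [sub_zero] at h3
  exact ge_of_tendsto h3 (eventually_mem_nhdsWithin.mono fun δ hδ => step δ hδ)

end UniformConvexity

/-! ### Linear lower bounds for the modulus -/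

section Modulus

variable {γ : ℝ≥0 → ℝ≥0∞}

theorem IsGammaU.map_mul_le (hγ : IsGammaU γ) {a : ℝ≥0} (ha : a ≤ 1) (r : ℝ≥0) :
    γ (a * r) ≤ a * γ r := by
  have := hγ.convex.2 (Set.mem_univ r) (Set.mem_univ 0) (zero_le (a := a)) (zero_le (a := 1 - a))
    (add_tsub_cancel_of_le ha)
  simpa [hγ.zero, ENNReal.smul_def] using this

/-- By convexity and `γ 0 = 0` the quotient `γ r / r` is non-decreasing, so its value at `δ` serves
as slope; truncating `γ δ` at `1` keeps the slope finite. -/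
theorem IsGammaU.exists_slope (hγ : IsGammaU γ) {δ : ℝ} (hδ : 0 < δ) :
    ∃ c : ℝ, 0 < c ∧ ∀ r : ℝ≥0, δ ≤ r → ENNReal.ofReal (c * r) ≤ γ r := by
  lift δ to ℝ≥0 using hδ.le
  have hδ' : 0 < δ := by exact_mod_cast hδ
  have hpos : 0 < min (γ δ) 1 := lt_min (hγ.pos δ hδ') one_pos
  have hfin : min (γ δ) 1 ≠ ⊤ := ((min_le_right _ _).trans_lt ENNReal.one_lt_top).ne
  refine ⟨(min (γ δ) 1).toReal / δ, div_pos (ENNReal.toReal_pos hpos.ne' hfin) hδ,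
    fun r hr => ?_⟩
  have hr : δ ≤ r := by exact_mod_cast hr
  have hr0 : 0 < r := hδ'.trans_le hr
  have h1 := hγ.map_mul_le (a := δ / r) (div_le_one_of_le₀ hr zero_le) r
  rw [div_mul_cancel₀ _ hr0.ne'] at h1
  have h2 : min (γ δ) 1 ≤ ((δ / r : ℝ≥0) : ℝ≥0∞) * γ r := (min_le_left _ _).trans h1
  have h3 : ENNReal.ofReal ((min (γ δ) 1).toReal / δ * r) =
      ((r / δ : ℝ≥0) : ℝ≥0∞) * min (γ δ) 1 := by
    rw [div_mul_eq_mul_div, mul_div_assoc, mul_comm, ENNReal.ofReal_mul (by positivity),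
      ENNReal.ofReal_toReal hfin]
    congr 1
    rw [← NNReal.coe_div, ENNReal.ofReal_coe_nnreal]
  rw [h3]
  calc ((r / δ : ℝ≥0) : ℝ≥0∞) * min (γ δ) 1
      ≤ ((r / δ : ℝ≥0) : ℝ≥0∞) * (((δ / r : ℝ≥0) : ℝ≥0∞) * γ r) := by gcongr
    _ = ((r / δ * (δ / r) : ℝ≥0) : ℝ≥0∞) * γ r := by rw [ENNReal.coe_mul, mul_assoc]
    _ = γ r := by
      have : r / δ * (δ / r) = 1 := by field_simp
      rw [this]; simp

end Modulus

/-! ### Minimizers of uniformly convex functions under linear perturbation -/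

section Minimizers

variable {X : Type*} [NormedAddCommGroup X] [NormedSpace ℝ X] {K : Set X} {H : X → ℝ}
  {γ : ℝ≥0 → ℝ≥0∞}

theorem IsUnifConvexOn.midpoint (huc : IsUnifConvexOn K H γ) {x y : X} (hx : x ∈ K) (hy : y ∈ K) :
    γ (‖y - x‖₊ / 2) ≤
      ENNReal.ofReal (H x + H y - 2 * H ((1 / 2 : ℝ) • x + (1 / 2 : ℝ) • y)) := by
  have := huc x hx y hy (1 / 2) (by norm_num) (by norm_num)
  have e1 : Real.toNNReal (1 - 1 / 2) * ‖y - x‖₊ = ‖y - x‖₊ / 2 := by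
    ext; push_cast; rw [Real.coe_toNNReal _ (by norm_num)]; ring
  rw [e1] at this
  convert this using 2
  rw [show (1 : ℝ) - 1 / 2 = 1 / 2 by norm_num]
  ring

/-- Uniformly convex functions grow faster than linearly. -/
theorem IsUnifConvexOn.bddAbove_sub (hγ : IsGammaU γ) (hconv : ConvexOn ℝ K H)
    (hl : IsSeqLscOn K H) (huc : IsUnifConvexOn K H γ) (hK : K.Nonempty) (ξ : StrongDual ℝ X) :
    ∃ B : ℝ, ∀ x ∈ K, ξ x - H x ≤ B := by
  obtain ⟨x₀, hx₀⟩ := hK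
  obtain ⟨ρ, hρ, hball⟩ := hl.exists_ball (m := x₀) one_pos
  set δ := ρ / 2 with hδdef
  have hδ : 0 < δ := by positivity
  obtain ⟨c', hc', hslope⟩ := hγ.exists_slope hδ
  set c := c' * δ with hcdef
  have hc : 0 < c := by positivity
  have hsecond : ∀ x ∈ K, ∀ y ∈ K, 2 * δ ≤ ‖y - x‖ →
      c ≤ H x + H y - 2 * H ((1 / 2 : ℝ) • x + (1 / 2 : ℝ) • y) := by
    intro x hx y hy hxy
    have h1 := (hslope (‖y - x‖₊ / 2) (by push_cast; linarith)).trans (huc.midpoint hx hy)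
    have h2 : c ≤ c' * ((‖y - x‖₊ / 2 : ℝ≥0) : ℝ) := by
      push_cast
      rw [hcdef]
      gcongr
      linarith
    have h3 : ENNReal.ofReal c ≤ _ := (ENNReal.ofReal_le_ofReal h2).trans h1
    by_contra! hlt
    exact absurd h3 (not_le.2 ((ENNReal.ofReal_lt_ofReal_iff hc).2 hlt))
  set P := 1 + 2 * δ * ‖ξ‖ with hP
  have hP0 : 0 ≤ P := by positivity
  refine ⟨ξ x₀ - H x₀ + P + P ^ 2 / c + 2 * P + c, fun x hx => ?_⟩
  have hξ : ξ x ≤ ξ x₀ + ‖ξ‖ * ‖x - x₀‖ := by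
    have h1 := (le_abs_self _).trans (ξ.le_opNorm (x - x₀))
    rw [map_sub] at h1
    linarith
  have hsq : 0 ≤ P ^ 2 / c := by positivity
  rcases lt_or_ge ‖x - x₀‖ δ with hlt | hge
  · have h1 := hball x hx (by linarith)
    have h2 : ‖ξ‖ * ‖x - x₀‖ ≤ ‖ξ‖ * δ := by gcongr
    have h3 : 0 ≤ ‖ξ‖ * δ := by positivity
    linarith
  · set r := ‖x - x₀‖ with hr
    -- The segment is cut into `N` steps of length between `δ` and `2 * δ = ρ`. The first step stays
    -- in the ball where `H` drops by at most `1`, and points two steps apart are far enough for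
    -- second differences of at least `c`. Increments thus grow linearly and `H` quadratically in
    -- `N`, which beats `‖ξ‖ * r ≤ 2 * δ * ‖ξ‖ * N`.
    set N := ⌊r / δ⌋₊ with hN
    have hN1 : 1 ≤ N := (Nat.one_le_floor_iff _).2 ((one_le_div hδ).2 hge)
    have hN1' : (1 : ℝ) ≤ N := by exact_mod_cast hN1
    have hNr : N * δ ≤ r := (le_div_iff₀ hδ).1 (Nat.floor_le (by positivity))
    have hrN : r < (N + 1) * δ := (div_lt_iff₀ hδ).1 (Nat.lt_floor_add_one _)
    let z : ℕ → X := fun k => x₀ + ((k : ℝ) / N) • (x - x₀)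
    have hzK : ∀ k, k ≤ N → z k ∈ K := fun k hk => by
      have : z k = (1 - (k : ℝ) / N) • x₀ + ((k : ℝ) / N) • x := by simp only [z]; module
      rw [this]
      have h1 : (k : ℝ) / N ≤ 1 := div_le_one_of_le₀ (by exact_mod_cast hk) (by positivity)
      exact hconv.1 hx₀ hx (by linarith) (by positivity) (by ring)
    have hstep : ∀ k, k + 1 ≤ N → H (z k) - 1 + k * c ≤ H (z (k + 1)) := by
      intro k
      induction k with
      | zero =>
        intro h1
        have h2 := hball (z 1) (hzK 1 h1) (by
          have : z 1 - x₀ = ((1 : ℝ) / N) • (x - x₀) := by simp [z]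
          rw [this, norm_smul, Real.norm_of_nonneg (by positivity), ← hr, div_mul_eq_mul_div,
            one_mul, div_lt_iff₀ (by positivity)]
          nlinarith)
        have h3 : z 0 = x₀ := by simp [z]
        rw [h3]
        simp only [zero_add, Nat.cast_zero, zero_mul, add_zero]
        exact h2.le
      | succ k ih =>
        intro hk
        have h1 := ih (by omega)
        have hmid : (1 / 2 : ℝ) • z k + (1 / 2 : ℝ) • z (k + 1 + 1) = z (k + 1) := by
          simp only [z]; push_cast; module
        have hdist : z (k + 1 + 1) - z k = ((2 : ℝ) / N) • (x - x₀) := by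
          simp only [z]; push_cast; module
        have h2 := hsecond (z k) (hzK _ (by omega)) (z (k + 1 + 1)) (hzK _ hk) (by
          rw [hdist, norm_smul, Real.norm_of_nonneg (by positivity), ← hr, div_mul_eq_mul_div,
            le_div_iff₀ (by positivity)]
          nlinarith)
        rw [hmid] at h2
        push_cast
        linarith
    have hsum : ∀ k, k ≤ N → H x₀ - k + c * (k * (k - 1) / 2) ≤ H (z k) := by
      intro k
      induction k with
      | zero => intro _; simp [z]
      | succ k ih =>
        intro hk
        have h1 := ih (by omega)
        have h2 := hstep k hk
        push_cast
        linarith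
    have hzN : z N = x := by
      have : (N : ℝ) / N = 1 := div_self (by positivity)
      simp [z, this]
    have h1 := hsum N le_rfl
    rw [hzN] at h1
    have h2 : ‖ξ‖ * r ≤ ‖ξ‖ * (2 * δ * N) := by
      gcongr
      nlinarith
    have h3 : ξ x - H x ≤ ξ x₀ - H x₀ + P * N - c * (N * (N - 1) / 2) := by
      rw [hP]; linarith
    have h4 : P * N - c * (N * (N - 1) / 2) ≤ P ^ 2 / c + P + c := by
      have e : (P ^ 2 / c + P + c) * c = P ^ 2 + P * c + c ^ 2 := by field_simp
      have h5 : (P * N - c * (N * (N - 1) / 2)) * c ≤ (P ^ 2 / c + P + c) * c := by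
        rw [e]
        nlinarith [sq_nonneg (c * N - P - c / 2), mul_nonneg hP0 hc.le]
      exact le_of_mul_le_mul_right h5 hc
    linarith

/-- Two almost minimizers of `H - ξ` far from each other would have a midpoint below the infimum.
Minimizing sequences are therefore Cauchy, and completeness does the work of weak compactness. -/
theorem IsUnifConvexOn.exists_minimizer [CompleteSpace X] (hγ : IsGammaU γ)
    (hconv : ConvexOn ℝ K H) (hl : IsSeqLscOn K H) (huc : IsUnifConvexOn K H γ)
    (hK : K.Nonempty) (ξ : StrongDual ℝ X) :
    ∃ x ∈ K, ∀ y ∈ K, H x + ξ (y - x) ≤ H y := by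
  obtain ⟨B, hB⟩ := huc.bddAbove_sub hγ hconv hl hK ξ
  let g : X → ℝ := fun x => H x - ξ x
  have hbdd : BddBelow (g '' K) := ⟨-B, by
    rintro _ ⟨x, hx, rfl⟩; simp only [g]; linarith [hB x hx]⟩
  set I := sInf (g '' K) with hI
  have hIle : ∀ x ∈ K, I ≤ g x := fun x hx => csInf_le hbdd ⟨x, hx, rfl⟩
  have hex : ∀ n : ℕ, ∃ x ∈ K, g x < I + 1 / ((n : ℝ) + 1) := fun n => by
    obtain ⟨_, ⟨x, hx, rfl⟩, h⟩ := exists_lt_of_csInf_lt (hK.image g)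
      (lt_add_of_pos_right I (by positivity : (0 : ℝ) < 1 / ((n : ℝ) + 1)))
    exact ⟨x, hx, h⟩
  choose v hvK hv using hex
  have hcauchy : CauchySeq v := by
    rw [Metric.cauchySeq_iff]
    intro ε hε
    obtain ⟨c, hc, hslope⟩ := hγ.exists_slope (half_pos hε)
    obtain ⟨N, hN⟩ := exists_nat_one_div_lt (by positivity : (0 : ℝ) < c * (ε / 2) / 2)
    refine ⟨N, fun m hm n hn => ?_⟩
    by_contra! hge
    rw [dist_eq_norm] at hge
    have h1 := (hslope (‖v m - v n‖₊ / 2) (by push_cast; linarith)).trans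
      (huc.midpoint (hvK n) (hvK m))
    have hmid := hIle _ (hconv.1 (hvK n) (hvK m) (by norm_num : (0 : ℝ) ≤ 1 / 2)
      (by norm_num : (0 : ℝ) ≤ 1 / 2) (by norm_num))
    have hn' : ∀ k ≥ N, g (v k) < I + c * (ε / 2) / 2 := fun k hk => by
      have h2 : 1 / ((k : ℝ) + 1) ≤ 1 / ((N : ℝ) + 1) := by gcongr
      linarith [hv k]
    have h2 := hn' m hm
    have h3 := hn' n hn
    simp only [g, map_add, map_smul, smul_eq_mul] at hmid h2 h3
    set w := (1 / 2 : ℝ) • v n + (1 / 2 : ℝ) • v m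
    have h4 : H (v n) + H (v m) - 2 * H w < c * (ε / 2) := by linarith
    have h5 : c * (ε / 2) ≤ c * ((‖v m - v n‖₊ / 2 : ℝ≥0) : ℝ) := by
      push_cast
      gcongr
    exact absurd h1 (not_le.2 ((ENNReal.ofReal_lt_ofReal_iff (by
      exact lt_of_lt_of_le (by positivity) h5)).2 (h4.trans_le h5)))
  obtain ⟨x, hx⟩ := cauchySeq_tendsto_of_complete hcauchy
  have hξ : Tendsto (fun n => ξ (v n)) atTop (𝓝 (ξ x)) := (ξ.continuous.tendsto x).comp hx
  obtain ⟨hxK, hHx⟩ := hl v x (I + ξ x) hvK hx (by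
    intro ε hε
    filter_upwards [hξ.eventually (gt_mem_nhds (lt_add_of_pos_right _ (half_pos hε))),
      tendsto_one_div_add_atTop_nhds_zero_nat.eventually (gt_mem_nhds (half_pos hε))]
      with n h1 h2
    have := hv n
    simp only [g] at this
    linarith)
  refine ⟨x, hxK, fun y hy => ?_⟩
  have := hIle y hy
  simp only [g] at this
  rw [map_sub]
  linarith

/-- Unlike `HasUnifGrowth`, this holds for every subgradient `ξ` at `x`: the subgradient inequality
at a point of the segment bounds the convexity gap divided by `l`, and `l` is taken small by lower
semicontinuity of `γ`. -/
theorem IsUnifConvexOn.growth (hγ : IsGammaU γ) (hconv : ConvexOn ℝ K H)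
    (huc : IsUnifConvexOn K H γ) {ξ : StrongDual ℝ X} {x : X} (hx : x ∈ K)
    (hξ : ∀ y ∈ K, H x + ξ (y - x) ≤ H y) {y : X} (hy : y ∈ K) :
    γ ‖y - x‖₊ ≤ ENNReal.ofReal (H y - H x - ξ (y - x)) := by
  refine le_of_forall_lt fun c hc => ?_
  have h1 : Tendsto (fun l : ℝ => Real.toNNReal (1 - l) * ‖y - x‖₊) (𝓝[>] 0)
      (𝓝 ‖y - x‖₊) := by
    have h1 : Continuous fun l : ℝ => Real.toNNReal (1 - l) * ‖y - x‖₊ := by fun_prop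
    have h2 := h1.tendsto 0
    simp only [sub_zero, Real.toNNReal_one, one_mul] at h2
    exact h2.mono_left nhdsWithin_le_nhds
  obtain ⟨l, h2, h3, h4⟩ := ((h1.eventually (hγ.lsc _ c hc)).and
    (eventually_mem_nhdsWithin.and (nhdsWithin_le_nhds (gt_mem_nhds one_pos)))).exists
  have hl0 : 0 < l := h3
  have hl1 : l < 1 := h4
  refine h2.trans_le ((huc x hx y hy l hl0 hl1).trans (ENNReal.ofReal_le_ofReal ?_))
  rw [div_le_iff₀ hl0]
  have h5 := hξ _ (hconv.1 hx hy (by linarith : (0 : ℝ) ≤ 1 - l) hl0.le (by ring))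
  have h6 : (1 - l) • x + l • y - x = l • (y - x) := by module
  rw [h6, map_smul, smul_eq_mul] at h5
  linarith

end Minimizers

/-! ### Extended real functions, conjugates and their gradients -/

section Conjugate

variable {X : Type*} [NormedAddCommGroup X] [NormedSpace ℝ X] {h : X → EReal}

theorem IsProper.coe_toReal {X : Type*} {h : X → EReal} (hp : IsProper h) {x : X} (hx : x ∈ effDom h) :
    ((h x).toReal : EReal) = h x :=
  EReal.coe_toReal (ne_of_lt hx) (hp.1 x).ne'

theorem IsProper.convexOn_toReal (hp : IsProper h) (hc : IsConvex h) :
    ConvexOn ℝ (effDom h) fun x => (h x).toReal := by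
  have key : ∀ x ∈ effDom h, ∀ y ∈ effDom h, ∀ a b : ℝ, 0 < a → 0 < b → a + b = 1 →
      h (a • x + b • y) ≤ ((a * (h x).toReal + b * (h y).toReal : ℝ) : EReal) := by
    intro x hx y hy a b ha hb hab
    have := hc x y a b ha hb hab
    rw [← hp.coe_toReal hx, ← hp.coe_toReal hy] at this
    exact_mod_cast this
  have hcv : Convex ℝ (effDom h) := by
    rw [convex_iff_forall_pos]
    exact fun x hx y hy a b ha hb hab =>
      (key x hx y hy a b ha hb hab).trans_lt (EReal.coe_lt_top _)
  rw [convexOn_iff_forall_pos]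
  refine ⟨hcv, fun x hx y hy a b ha hb hab => ?_⟩
  have h1 := key x hx y hy a b ha hb hab
  rw [← hp.coe_toReal (hcv hx hy ha.le hb.le hab)] at h1
  exact_mod_cast h1

theorem IsProper.isSeqLscOn_toReal {X : Type*} [NormedAddCommGroup X] {h : X → EReal}
    (hp : IsProper h) (hl : LowerSemicontinuous h) :
    IsSeqLscOn (effDom h) fun x => (h x).toReal := by
  intro v x c hv hvx hc
  have key : ∀ ε > 0, h x ≤ ((c + ε : ℝ) : EReal) := by
    intro ε hε
    by_contra! hlt
    obtain ⟨n, h1, h2⟩ := ((hvx.eventually (hl x _ hlt)).and (hc ε hε)).exists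
    rw [← hp.coe_toReal (hv n)] at h1
    exact absurd h2 (not_le.2 (by exact_mod_cast h1))
  have hx : x ∈ effDom h := (key 1 one_pos).trans_lt (EReal.coe_lt_top _)
  refine ⟨hx, le_of_forall_pos_le_add fun ε hε => ?_⟩
  have h1 := key ε hε
  rw [← hp.coe_toReal hx] at h1
  exact_mod_cast h1

theorem IsProper.hasUnifGrowth_toReal (hp : IsProper h) {γ : ℝ≥0 → ℝ≥0∞}
    (hg : ∀ x₀ ∈ domSubdiff h, ∃ ξ₀ : StrongDual ℝ X, HasGrowth h γ x₀ ξ₀) :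
    HasUnifGrowth (effDom h) (fun x => (h x).toReal) γ := by
  rintro x₀ hx₀ ⟨ξ, hξ⟩
  obtain ⟨ξ₀, hξ₀⟩ := hg x₀ ⟨ξ, fun y => by
    by_cases hy : y ∈ effDom h
    · rw [← hp.coe_toReal hy, ← hp.coe_toReal hx₀]
      exact_mod_cast hξ y hy
    · have htop : h y = ⊤ := not_lt_top_iff.1 hy
      rw [htop]; exact le_top⟩
  refine ⟨ξ₀, fun z hz => ?_⟩
  have h1 := hξ₀ z
  rw [← hp.coe_toReal hz, ← hp.coe_toReal hx₀, ← EReal.coe_add] at h1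
  -- An infinite modulus would force `h z = ⊤`.
  have hfin : γ ‖z - x₀‖₊ ≠ ⊤ := by
    intro htop
    rw [htop, EReal.coe_ennreal_top, EReal.coe_add_top] at h1
    exact absurd h1 (not_le.2 (EReal.coe_lt_top _))
  lift γ ‖z - x₀‖₊ to ℝ≥0 using hfin with a ha
  rw [EReal.coe_nnreal_eq_coe_real] at h1
  have h2 : (h x₀).toReal + ξ₀ (z - x₀) + a ≤ (h z).toReal := by exact_mod_cast h1
  refine ⟨by linarith [a.2], ?_⟩
  rw [← ENNReal.ofReal_coe_nnreal]
  exact ENNReal.ofReal_le_ofReal (by linarith)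

theorem IsProper.le_conj (hp : IsProper h) (ξ : StrongDual ℝ X) {x : X} (hx : x ∈ effDom h) :
    ((ξ x - (h x).toReal : ℝ) : EReal) ≤ conj h ξ := by
  rw [EReal.coe_sub, hp.coe_toReal hx]
  exact le_iSup (fun x => ((ξ x : ℝ) : EReal) - h x) x

theorem IsProper.conj_le (hp : IsProper h) {ξ : StrongDual ℝ X} {B : ℝ}
    (hB : ∀ x ∈ effDom h, ξ x - (h x).toReal ≤ B) : conj h ξ ≤ B := by
  refine iSup_le fun x => ?_
  by_cases hx : x ∈ effDom h
  · rw [← hp.coe_toReal hx]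
    exact_mod_cast hB x hx
  · have htop : h x = ⊤ := not_lt_top_iff.1 hx
    rw [htop]; simp

/-- `x` minimizes `h - ξ`. -/
def IsMinimizer (h : X → EReal) (ξ : StrongDual ℝ X) (x : X) : Prop :=
  x ∈ effDom h ∧ ∀ y ∈ effDom h, (h x).toReal + ξ (y - x) ≤ (h y).toReal

theorem IsMinimizer.conj_eq (hp : IsProper h) {ξ : StrongDual ℝ X} {x : X}
    (hx : IsMinimizer h ξ x) : conj h ξ = ((ξ x - (h x).toReal : ℝ) : EReal) := by
  refine le_antisymm (hp.conj_le fun y hy => ?_) (hp.le_conj ξ hx.1)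
  have := hx.2 y hy
  rw [map_sub] at this
  linarith

/-- The linearization error of `conj h` at `ξ` is the supremum over `y` of `(ζ - ξ) (y - x)` minus
the growth of `h - ξ` from `x` to `y`. Points within `ε` of `x` contribute at most `ε * ‖ζ - ξ‖`;
farther out the growth is at least `c * ‖y - x‖` and wins as soon as `‖ζ - ξ‖ ≤ c`. -/
theorem IsMinimizer.isFrechetGradient (hp : IsProper h) {γ : ℝ≥0 → ℝ≥0∞} (hγ : IsGammaU γ)
    (hmin : ∀ ξ : StrongDual ℝ X, ∃ x, IsMinimizer h ξ x)
    {ξ : StrongDual ℝ X} {x : X} (hx : IsMinimizer h ξ x)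
    (hgr : ∀ y ∈ effDom h,
      γ ‖y - x‖₊ ≤ ENNReal.ofReal ((h y).toReal - (h x).toReal - ξ (y - x))) :
    IsFrechetGradient (conj h) ξ x := by
  have hfin : ∀ ζ, conj h ζ = (((conj h ζ).toReal : ℝ) : EReal) := fun ζ => by
    obtain ⟨y, hy⟩ := hmin ζ
    rw [hy.conj_eq hp, EReal.toReal_coe]
  refine ⟨Eventually.of_forall fun ζ => ?_, ?_⟩
  · rw [hfin ζ]; exact ⟨EReal.coe_ne_bot _, EReal.coe_ne_top _⟩
  rw [hasFDerivAt_iff_isLittleO, Asymptotics.isLittleO_iff]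
  intro ε hε
  obtain ⟨c, hc, hslope⟩ := hγ.exists_slope hε
  filter_upwards [Metric.closedBall_mem_nhds ξ hc] with ζ hζ
  rw [mem_closedBall_iff_norm] at hζ
  have h0 : (conj h ξ).toReal = ξ x - (h x).toReal := by rw [hx.conj_eq hp, EReal.toReal_coe]
  have hlow : ζ x - (h x).toReal ≤ (conj h ζ).toReal := by
    have := hp.le_conj ζ hx.1
    rw [hfin ζ] at this
    exact_mod_cast this
  have hup : (conj h ζ).toReal ≤ ζ x - (h x).toReal + ε * ‖ζ - ξ‖ := by
    have : conj h ζ ≤ ((ζ x - (h x).toReal + ε * ‖ζ - ξ‖ : ℝ) : EReal) := by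
      refine hp.conj_le fun y hy => ?_
      have h1 : (ζ - ξ) (y - x) ≤ ‖ζ - ξ‖ * ‖y - x‖ :=
        (le_abs_self _).trans ((ζ - ξ).le_opNorm _)
      have h2 := hx.2 y hy
      simp only [map_sub, sub_apply] at h1 h2
      rcases le_total ‖y - x‖ ε with hle | hge
      · have : ‖ζ - ξ‖ * ‖y - x‖ ≤ ε * ‖ζ - ξ‖ := by
          rw [mul_comm]; gcongr
        linarith
      · have h3 := (hslope ‖y - x‖₊ hge).trans (hgr y hy)
        have hpos : 0 < ‖y - x‖ := hε.trans_le hge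
        have h4 : c * ‖y - x‖ ≤ (h y).toReal - (h x).toReal - ξ (y - x) := by
          by_contra! hlt
          exact absurd h3 (not_le.2 ((ENNReal.ofReal_lt_ofReal_iff (by
            rw [coe_nnnorm]; positivity)).2 hlt))
        rw [map_sub] at h4
        have h5 : ‖ζ - ξ‖ * ‖y - x‖ ≤ c * ‖y - x‖ := by gcongr
        have h6 : 0 ≤ ε * ‖ζ - ξ‖ := by positivity
        linarith
    rw [hfin ζ] at this
    exact_mod_cast this
  rw [h0, NormedSpace.dual_def, sub_apply, Real.norm_eq_abs, abs_le]
  have h6 : 0 ≤ ε * ‖ζ - ξ‖ := by positivity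
  constructor <;> linarith

/-- Derivatives are unique and `X` embeds in its bidual; hence any play of Dual Averaging is the
minimizer. -/
theorem IsFrechetGradient.eq {F : StrongDual ℝ X → EReal} {ξ : StrongDual ℝ X} {x y : X}
    (hx : IsFrechetGradient F ξ x) (hy : IsFrechetGradient F ξ y) : x = y :=
  (NormedSpace.inclusionInDoubleDualLi ℝ (E := X)).injective (hx.2.unique hy.2)

end Conjugate

/-! ### Probability densities: room inside the domain of `h` -/

section DensitySets

variable {S : Type*} [MeasurableSpace S] {μ : Measure S} {p : ℝ≥0∞}

theorem mem_densities_iff {x : Lp ℝ p μ} :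
    x ∈ densities μ p ↔ 0 ≤ᵐ[μ] x ∧ Integrable x μ ∧ ∫ s, x s ∂μ = 1 := by
  have hmeas : AEStronglyMeasurable x μ := Lp.aestronglyMeasurable x
  constructor
  · rintro ⟨h0, h1⟩
    have hint : Integrable x μ := memLp_one_iff_integrable.1 ⟨hmeas, by rw [h1]; simp⟩
    refine ⟨h0, hint, ?_⟩
    rw [integral_eq_lintegral_of_nonneg_ae h0 hmeas]
    have : ∫⁻ s, ENNReal.ofReal (x s) ∂μ = eLpNorm x 1 μ := by
      rw [eLpNorm_one_eq_lintegral_enorm]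
      refine lintegral_congr_ae (h0.mono fun s hs => ?_)
      exact (Real.enorm_of_nonneg hs).symm
    rw [this, h1, ENNReal.toReal_one]
  · rintro ⟨h0, hint, h1⟩
    refine ⟨h0, ?_⟩
    have : eLpNorm x 1 μ = ENNReal.ofReal (∫ s, x s ∂μ) := by
      rw [eLpNorm_one_eq_lintegral_enorm, ofReal_integral_eq_lintegral_ofReal hint h0]
      refine lintegral_congr_ae (h0.mono fun s hs => ?_)
      exact Real.enorm_of_nonneg hs
    rw [this, h1, ENNReal.ofReal_one]

/-- Norm convergence gives almost everywhere convergence along a subsequence, extracted for one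
coordinate after the other. This realizes `L¹ ∩ Lᵖ` as a complete space. -/
theorem isClosed_setOf_ae_eq {p q : ℝ≥0∞} [Fact (1 ≤ p)] [Fact (1 ≤ q)] :
    IsClosed {z : Lp ℝ p μ × Lp ℝ q μ | z.1 =ᵐ[μ] z.2} := by
  refine IsSeqClosed.isClosed fun z w hz hlim => ?_
  have h1 : Tendsto (fun n => (z n).1) atTop (𝓝 w.1) := (continuous_fst.tendsto w).comp hlim
  have h2 : Tendsto (fun n => (z n).2) atTop (𝓝 w.2) := (continuous_snd.tendsto w).comp hlim
  obtain ⟨ns, hns, hae⟩ := (tendstoInMeasure_of_tendsto_Lp h1).exists_seq_tendsto_ae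
  obtain ⟨ms, hms, hae'⟩ :=
    (tendstoInMeasure_of_tendsto_Lp (h2.comp hns.tendsto_atTop)).exists_seq_tendsto_ae
  filter_upwards [hae, hae', ae_all_iff.2 hz] with s hs hs' heq
  refine tendsto_nhds_unique (hs.comp hms.tendsto_atTop) (hs'.congr fun n => ?_)
  exact (heq _).symm

variable [Fact (1 ≤ p)]

/-- By Baire's theorem a lower semicontinuous function that is finite on all densities is bounded
on a ball of `L¹ ∩ Lᵖ`. -/
theorem exists_ball_bounded {h : Lp ℝ p μ → EReal} (hl : LowerSemicontinuous h)
    (hfin : ∀ x ∈ densities μ p, h x < ⊤) (hne : (densities μ p).Nonempty) :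
    ∃ x₀ ∈ densities μ p, ∃ ρ > 0, ∃ M : ℝ, ∀ x ∈ densities μ p, ‖x - x₀‖ < ρ →
      ∫ s, |x s - x₀ s| ∂μ < ρ → h x ≤ M := by
  -- Since `μ` may be infinite, unit mass need not be a closed condition in `Lᵖ`; the `L¹`
  -- coordinate makes it closed, as Baire's theorem requires.
  let G : Set (Lp ℝ 1 μ × Lp ℝ p μ) := {z | z.1 =ᵐ[μ] z.2} ∩ {z | 0 ≤ z.2 ∧ ‖z.1‖ = 1}
  have hGc : IsClosed G := isClosed_setOf_ae_eq.inter
    ((isClosed_nonneg.preimage continuous_snd).inter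
      (isClosed_eq continuous_fst.norm continuous_const))
  have hGmem : ∀ z : Lp ℝ 1 μ × Lp ℝ p μ, z ∈ G → z.2 ∈ densities μ p := by
    rintro z ⟨h1, h2, h3⟩
    refine ⟨(Lp.coeFn_nonneg _).2 h2, ?_⟩
    rw [← eLpNorm_congr_ae h1]
    rw [Lp.norm_def, ENNReal.toReal_eq_one_iff] at h3
    exact h3
  have hmemG : ∀ x ∈ densities μ p, ∃ z ∈ G, z.2 = x := by
    intro x hx
    have hint := (mem_densities_iff.1 hx).2.1
    refine ⟨(hint.toL1 x, x), ⟨hint.coeFn_toL1, (Lp.coeFn_nonneg _).1 hx.1, ?_⟩, rfl⟩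
    rw [Lp.norm_def, eLpNorm_congr_ae hint.coeFn_toL1, hx.2, ENNReal.toReal_one]
  have : CompleteSpace G := hGc.completeSpace_coe
  obtain ⟨x₁, hx₁⟩ := hne
  obtain ⟨z₁, hz₁, -⟩ := hmemG x₁ hx₁
  have : Nonempty G := ⟨⟨z₁, hz₁⟩⟩
  obtain ⟨n, z₀, hz₀⟩ := nonempty_interior_of_iUnion_of_closed
    (f := fun n : ℕ => {z : G | h z.1.2 ≤ ((n : ℝ) : EReal)})
    (fun n => (hl.isClosed_preimage _).preimage (continuous_snd.comp continuous_subtype_val))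
    (by
      rw [Set.eq_univ_iff_forall]
      intro z
      have hz := hfin _ (hGmem z.1 z.2)
      obtain ⟨n, hn⟩ := exists_nat_ge (h z.1.2).toReal
      exact Set.mem_iUnion.2 ⟨n, (EReal.le_coe_toReal hz.ne).trans (by exact_mod_cast hn)⟩)
  obtain ⟨ρ, hρ, hball⟩ := Metric.mem_nhds_iff.1 (mem_interior_iff_mem_nhds.1 hz₀)
  refine ⟨z₀.1.2, hGmem _ z₀.2, ρ, hρ, n, fun x hx hxp hx1 => ?_⟩
  obtain ⟨z, hz, rfl⟩ := hmemG x hx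
  refine hball (a := ⟨z, hz⟩) ?_
  rw [Metric.mem_ball, Subtype.dist_eq, Prod.dist_eq, max_lt_iff]
  refine ⟨?_, by rwa [dist_eq_norm]⟩
  change dist z.1 z₀.1.1 < ρ
  rw [L1.dist_eq_integral_dist]
  convert hx1 using 1
  refine integral_congr_ae ?_
  filter_upwards [hz.1, z₀.2.1] with s h2 h3
  rw [h2, h3, Real.dist_eq]

/-- Write `t • (x - y) = u - v` with `u`, `v` the positive and negative parts, of equal mass `s`.
Then `(1 - s) • x₀ + v` and `(1 - s) • x₀ + u` are densities differing by the perturbation, and both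
lie in the ball around `x₀` where `h` is bounded if `s` and the norms are small. -/
theorem hasPerturbations_densities {h : Lp ℝ p μ → EReal} (hp : IsProper h)
    (hl : LowerSemicontinuous h) (hdom : effDom h = densities μ p) :
    ∃ M R r : ℝ, 0 < r ∧
      HasPerturbations (densities μ p) (fun x => (h x).toReal) M R r := by
  obtain ⟨x₀, hx₀, ρ, hρ, M, hM⟩ := exists_ball_bounded hl
    (fun x hx => by rw [← hdom] at hx; exact hx) (hdom ▸ hp.2)
  have hx₀' := mem_densities_iff.1 hx₀
  -- adding a small nonnegative function to a multiple of `x₀`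
  have hsmall : ∀ (s : ℝ) (w : Lp ℝ p μ), 0 ≤ s → s ≤ 1 → 0 ≤ᵐ[μ] w → Integrable w μ →
      ∫ a, w a ∂μ = s → 2 * s < ρ → s * ‖x₀‖ + ‖w‖ < ρ →
      (1 - s) • x₀ + w ∈ densities μ p ∧ h ((1 - s) • x₀ + w) ≤ M := by
    intro s w hs0 hs1 hw0 hwint hws h2s hsn
    have hc : ⇑((1 - s) • x₀ + w) =ᵐ[μ] fun a => (1 - s) * x₀ a + w a := by
      filter_upwards [Lp.coeFn_add ((1 - s) • x₀) w, Lp.coeFn_smul (1 - s) x₀] with a h1 h2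
      rw [h1, Pi.add_apply, h2]; rfl
    have hmem : (1 - s) • x₀ + w ∈ densities μ p := by
      rw [mem_densities_iff]
      refine ⟨?_, ((hx₀'.2.1.const_mul _).add hwint).congr hc.symm, ?_⟩
      · filter_upwards [hc, hx₀'.1, hw0] with a h1 h2 h3
        rw [h1]
        exact add_nonneg (mul_nonneg (by linarith) h2) h3
      · rw [integral_congr_ae hc, integral_add (hx₀'.2.1.const_mul _) hwint,
          integral_const_mul, hx₀'.2.2, hws]
        ring
    refine ⟨hmem, hM _ hmem ?_ ?_⟩
    · have : (1 - s) • x₀ + w - x₀ = w - s • x₀ := by module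
      rw [this]
      refine (norm_sub_le _ _).trans_lt ?_
      rw [norm_smul, Real.norm_of_nonneg hs0]
      linarith
    · refine lt_of_le_of_lt ?_ h2s
      calc ∫ a, |((1 - s) • x₀ + w : Lp ℝ p μ) a - x₀ a| ∂μ ≤ ∫ a, (s * x₀ a + w a) ∂μ := by
            refine integral_mono_of_nonneg (ae_of_all _ fun a => abs_nonneg _)
              ((hx₀'.2.1.const_mul s).add hwint) ?_
            filter_upwards [hc, hx₀'.1, hw0] with a h1 h2 h3
            have h4 : 0 ≤ s * x₀ a := mul_nonneg hs0 h2
            have h5 : 0 ≤ w a := h3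
            rw [h1, abs_le]
            constructor <;> linarith
        _ = 2 * s := by
            rw [integral_add (hx₀'.2.1.const_mul s) hwint, integral_const_mul, hx₀'.2.2, hws]
            ring
  -- densities have norms bounded from below
  obtain ⟨c, hc, hcn⟩ : ∃ c > 0, ∀ y ∈ densities μ p, c ≤ ‖y‖ := by
    by_contra! hcon
    -- If densities `y n` tended to `0`, then `(1 - s) • x₀ + s • y n` would keep bounded cost, and
    -- lower semicontinuity would put the limit `(1 - s) • x₀`, of mass `1 - s`, in the domain of
    -- `h`.
    choose y hy hyn using fun n : ℕ => hcon (1 / ((n : ℝ) + 1)) (by positivity)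
    set s := min (1 / 2) (ρ / (2 * (‖x₀‖ + 2))) with hs
    have hs0 : 0 < s := lt_min (by norm_num) (by positivity)
    have hs1 : s ≤ 1 / 2 := min_le_left _ _
    have hs2 : s * (‖x₀‖ + 2) ≤ ρ / 2 := by
      calc s * (‖x₀‖ + 2) ≤ ρ / (2 * (‖x₀‖ + 2)) * (‖x₀‖ + 2) := by
            gcongr; exact min_le_right _ _
        _ = ρ / 2 := by field_simp
    have hsx : 0 ≤ s * ‖x₀‖ := by positivity
    have hle : ∀ n, h ((1 - s) • x₀ + s • y n) ≤ M := by
      intro n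
      have hyn' := mem_densities_iff.1 (hy n)
      have hcs := Lp.coeFn_smul s (y n)
      refine (hsmall s (s • y n) hs0.le (by linarith) ?_ ?_ ?_ (by linarith) ?_).2
      · filter_upwards [hcs, hyn'.1] with a h1 h2
        rw [h1]; exact mul_nonneg hs0.le h2
      · exact (hyn'.2.1.const_mul s).congr hcs.symm
      · rw [integral_congr_ae hcs]
        simp only [Pi.smul_apply, smul_eq_mul]
        rw [integral_const_mul, hyn'.2.2, mul_one]
      · rw [norm_smul, Real.norm_of_nonneg hs0.le]
        have h1 : ‖y n‖ ≤ 1 := (hyn n).le.trans (by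
          rw [div_le_one (by positivity)]; linarith [n.cast_nonneg (α := ℝ)])
        have : s * ‖y n‖ ≤ s * 1 := by gcongr
        linarith
    have hy0 : Tendsto y atTop (𝓝 0) :=
      squeeze_zero_norm (fun n => (hyn n).le) tendsto_one_div_add_atTop_nhds_zero_nat
    have hlim : Tendsto (fun n => (1 - s) • x₀ + s • y n) atTop (𝓝 ((1 - s) • x₀ + s • 0)) :=
      (hy0.const_smul s).const_add _
    have hmem : (1 - s) • x₀ + s • 0 ∈ effDom h :=
      ((hl.isClosed_preimage (M : EReal)).mem_of_tendsto hlim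
        (Eventually.of_forall hle)).trans_lt (EReal.coe_lt_top M)
    rw [hdom, smul_zero, add_zero, mem_densities_iff, integral_congr_ae (Lp.coeFn_smul _ _)] at hmem
    have h1 := hmem.2.2
    simp only [Pi.smul_apply, smul_eq_mul] at h1
    rw [integral_const_mul, hx₀'.2.2] at h1
    linarith
  -- As `s * c ≤ r`, the three bounds give in turn `s ≤ 1`, the `L¹` bound `2 * s < ρ`, and the `Lᵖ`
  -- bound `s * ‖x₀‖ + ‖w‖ < ρ`.
  set r := min c (min (c * ρ / 4) (ρ * c / (4 * (‖x₀‖ + c)))) with hr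
  have hr0 : 0 < r := by
    refine lt_min hc (lt_min ?_ ?_) <;> positivity
  have hr1 : r ≤ c := min_le_left _ _
  have hr2 : r ≤ c * ρ / 4 := (min_le_right _ _).trans (min_le_left _ _)
  have hr3 : r ≤ ρ * c / (4 * (‖x₀‖ + c)) := (min_le_right _ _).trans (min_le_right _ _)
  refine ⟨M, ‖x₀‖ + ρ, r, hr0, fun x hx y hy t ht htr => ?_⟩
  set w : Lp ℝ p μ := t • (x - y) with hw
  have hwn : ‖w‖ ≤ r := by rwa [hw, norm_smul, Real.norm_of_nonneg ht]
  have hx' := mem_densities_iff.1 hx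
  have hy' := mem_densities_iff.1 hy
  have hwc : ⇑w =ᵐ[μ] fun a => t * (x a - y a) := by
    filter_upwards [Lp.coeFn_smul t (x - y), Lp.coeFn_sub x y] with a h1 h2
    rw [h1, Pi.smul_apply, h2, Pi.sub_apply, smul_eq_mul]
  have hwint : Integrable w μ := ((hx'.2.1.sub hy'.2.1).const_mul t).congr hwc.symm
  have hw0 : ∫ a, w a ∂μ = 0 := by
    rw [integral_congr_ae hwc, integral_const_mul, integral_sub hx'.2.1 hy'.2.1, hx'.2.2, hy'.2.2]
    simp
  set u := Lp.posPart w with hu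
  set v := Lp.negPart w with hv
  have huc := Lp.coeFn_posPart w
  have hvc : ⇑v =ᵐ[μ] fun a => max (-w a) 0 := Lp.coeFn_negPart_eq_max w
  have huint : Integrable u μ := hwint.pos_part.congr huc.symm
  have hvint : Integrable v μ := hwint.neg_part.congr hvc.symm
  have hu0 : 0 ≤ᵐ[μ] u := huc.mono fun a ha => by rw [ha]; exact le_max_right _ _
  have hv0 : 0 ≤ᵐ[μ] v := hvc.mono fun a ha => by rw [ha]; exact le_max_right _ _
  have huv : v + w = u := by
    refine Lp.ext ?_
    filter_upwards [huc, hvc, Lp.coeFn_add v w] with a h1 h2 h3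
    rw [h3, Pi.add_apply, h1, h2]
    rcases le_total (w a) 0 with h | h
    · rw [max_eq_right h, max_eq_left (by linarith)]; ring
    · rw [max_eq_left h, max_eq_right (by linarith)]; ring
  have hun : ‖u‖ ≤ ‖w‖ := Lp.norm_le_norm_of_ae_le (huc.mono fun a ha => by
    rw [ha, Real.norm_eq_abs, Real.norm_eq_abs, abs_of_nonneg (le_max_right _ _)]
    exact max_le (le_abs_self _) (abs_nonneg _))
  have hvn : ‖v‖ ≤ ‖w‖ := Lp.norm_le_norm_of_ae_le (hvc.mono fun a ha => by
    rw [ha, Real.norm_eq_abs, Real.norm_eq_abs, abs_of_nonneg (le_max_right _ _)]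
    exact max_le (neg_le_abs _) (abs_nonneg _))
  set s := ∫ a, v a ∂μ with hs
  have hsu : ∫ a, u a ∂μ = s := by
    have : ⇑u =ᵐ[μ] fun a => v a + w a := by rw [← huv]; exact Lp.coeFn_add v w
    rw [integral_congr_ae this, integral_add hvint hwint, hw0, add_zero]
  have hs0 : 0 ≤ s := integral_nonneg_of_ae hv0
  have hsc : s * c ≤ r := by
    rcases hs0.eq_or_lt with h0 | hpos
    · rw [← h0, zero_mul]; exact hr0.le
    · have hmem : s⁻¹ • v ∈ densities μ p := by
        have hcs := Lp.coeFn_smul s⁻¹ v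
        rw [mem_densities_iff]
        refine ⟨?_, (hvint.const_mul _).congr hcs.symm, ?_⟩
        · filter_upwards [hcs, hv0] with a h1 h2
          rw [h1]; exact mul_nonneg (by positivity) h2
        · rw [integral_congr_ae hcs]
          simp only [Pi.smul_apply, smul_eq_mul]
          rw [integral_const_mul, ← hs, inv_mul_cancel₀ hpos.ne']
      have h1 := hcn _ hmem
      rw [norm_smul, Real.norm_of_nonneg (by positivity), inv_mul_eq_div, le_div_iff₀ hpos] at h1
      linarith
  have hs1 : s ≤ 1 := by
    by_contra! hlt
    nlinarith
  have hs2 : 2 * s < ρ := by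
    have : s ≤ ρ / 4 := by
      refine le_of_mul_le_mul_right ?_ hc
      linarith
    linarith
  have hs3 : ∀ b : Lp ℝ p μ, ‖b‖ ≤ ‖w‖ → s * ‖x₀‖ + ‖b‖ < ρ := by
    intro b hb
    have h1 : s ≤ r / c := (le_div_iff₀ hc).2 hsc
    have h2 : r * (4 * (‖x₀‖ + c)) ≤ ρ * c := (le_div_iff₀ (by positivity)).1 hr3
    have h3 : s * ‖x₀‖ ≤ r / c * ‖x₀‖ := by gcongr
    have h4 : r / c * ‖x₀‖ + r = r * (‖x₀‖ + c) / c := by field_simp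
    have h5 : r * (‖x₀‖ + c) / c ≤ ρ / 4 := by
      rw [div_le_iff₀ hc]; linarith
    linarith
  obtain ⟨hd, hdM⟩ := hsmall s v hs0 hs1 hv0 hvint rfl hs2 (hs3 v hvn)
  obtain ⟨hd', hdM'⟩ := hsmall s u hs0 hs1 hu0 huint hsu hs2 (hs3 u hun)
  have hreal : ∀ z ∈ densities μ p, h z ≤ M → (h z).toReal ≤ M := by
    intro z hz hzM
    rw [← hdom] at hz
    rw [← hp.coe_toReal hz] at hzM
    exact_mod_cast hzM
  have hadd : (1 - s) • x₀ + v + w = (1 - s) • x₀ + u := by rw [add_assoc, huv]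
  refine ⟨(1 - s) • x₀ + v, hd, hreal _ hd hdM, ?_, ?_, ?_⟩
  · refine (norm_add_le _ _).trans ?_
    rw [norm_smul, Real.norm_of_nonneg (by linarith)]
    have h1 : (1 - s) * ‖x₀‖ ≤ 1 * ‖x₀‖ := by gcongr; linarith
    have h2 := hs3 v hvn
    have h3 : 0 ≤ s * ‖x₀‖ := by positivity
    linarith
  · rw [hadd]; exact hd'
  · simp only [hadd]; exact hreal _ hd' hdM'

end DensitySets

/-! ### Stability of minimizers and the regret against a fixed decision -/

section Regret

variable {X : Type*} [NormedAddCommGroup X] [NormedSpace ℝ X] {h : X → EReal}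
  {γ : ℝ≥0 → ℝ≥0∞}

/-- Minimizers of `h - ξ` depend on `ξ` in a controlled way. -/
theorem enorm_sub_le_gammaTildeInv
    (hgr : ∀ (ξ : StrongDual ℝ X) (x : X), IsMinimizer h ξ x → ∀ y ∈ effDom h,
      γ ‖y - x‖₊ ≤ ENNReal.ofReal ((h y).toReal - (h x).toReal - ξ (y - x)))
    {ξ v : StrongDual ℝ X} {a : ℝ} (ha : 0 ≤ a) {x x' : X} (hx : IsMinimizer h ξ x)
    (hx' : IsMinimizer h (ξ + a • v) x') :
    ‖x' - x‖ₑ ≤ gammaTildeInv γ (ENNReal.ofReal a / 2 * ‖v‖ₑ) := by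
  refine le_iSup₂_of_le ‖x' - x‖₊ ?_ le_rfl
  have h1 := hgr ξ x hx x' hx'.1
  have h2 := hgr _ x' hx' x hx.1
  have h3 := hx.2 x' hx'.1
  have h4 := hx'.2 x hx.1
  rw [show ‖x - x'‖₊ = ‖x' - x‖₊ from NNReal.eq (norm_sub_rev x x')] at h2
  set d := ‖x' - x‖₊ with hd
  -- Growth from `x` to `x'` and from `x'` to `x`: in the sum the values of `h` and the slope `ξ`
  -- cancel, leaving `a * v (x' - x)`. The two copies of `γ d` produce the factor `1 / 2` in the
  -- bound.
  have h5 : 2 * γ d ≤ ENNReal.ofReal a * ‖v‖ₑ * d := by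
    calc 2 * γ d = γ d + γ d := two_mul _
      _ ≤ _ := add_le_add h1 h2
      _ = ENNReal.ofReal (a * v (x' - x)) := by
        rw [← ENNReal.ofReal_add (by linarith) (by linarith)]
        congr 1
        simp only [add_apply, smul_apply, map_sub, smul_eq_mul]
        ring
      _ ≤ ENNReal.ofReal (a * (‖v‖ * ‖x' - x‖)) := by
        refine ENNReal.ofReal_le_ofReal (mul_le_mul_of_nonneg_left ?_ ha)
        exact (le_abs_self _).trans (v.le_opNorm _)
      _ = _ := by
        rw [ENNReal.ofReal_mul ha, ENNReal.ofReal_mul (norm_nonneg _), ofReal_norm, ofReal_norm,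
          mul_assoc]
        rfl
  have hd0 : (d : ℝ≥0∞) = 0 → γ d = 0 := by
    intro h0
    rw [h0, mul_zero, nonpos_iff_eq_zero, mul_eq_zero] at h5
    exact h5.resolve_left two_ne_zero
  refine ENNReal.div_le_of_le_mul ?_
  have h6 : γ d = 2⁻¹ * (2 * γ d) := by
    rw [← mul_assoc, ENNReal.inv_mul_cancel two_ne_zero ENNReal.ofNat_ne_top, one_mul]
  calc γ d = 2⁻¹ * (2 * γ d) := h6
    _ ≤ 2⁻¹ * (ENNReal.ofReal a * ‖v‖ₑ * d) := by gcongr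
    _ = _ := by rw [ENNReal.div_eq_inv_mul]; ring

/-- The regret of Dual Averaging against a fixed decision of finite cost. -/
theorem regret_le_of_isMinimizer
    (hmin : ∀ ξ : StrongDual ℝ X, ∃ x, IsMinimizer h ξ x)
    (hgr : ∀ (ξ : StrongDual ℝ X) (x : X), IsMinimizer h ξ x → ∀ y ∈ effDom h,
      γ ‖y - x‖₊ ≤ ENNReal.ofReal ((h y).toReal - (h x).toReal - ξ (y - x)))
    {η : ℕ → ℝ} (hη : ∀ t, 0 < η t) (hηanti : ∀ t, η (t + 1) ≤ η t)
    {u : ℕ → StrongDual ℝ X} {x : ℕ → X}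
    (hx : ∀ t, IsMinimizer h (η t • ∑ τ ∈ Finset.Icc 1 t, u τ) (x (t + 1)))
    {x₀ : X} (hx₀ : IsMinimizer h 0 x₀) :
    ∃ g : ℕ → ℝ, (∀ τ, 1 ≤ τ → ENNReal.ofReal (g τ) ≤
        ‖u τ‖ₑ * gammaTildeInv γ (ENNReal.ofReal (η (τ - 1)) / 2 * ‖u τ‖ₑ)) ∧
      ∀ t, ∀ y ∈ effDom h, regret u x t y ≤
        ((h y).toReal - (h x₀).toReal) / η t + ∑ τ ∈ Finset.Icc 1 t, g τ := by
  -- The clairvoyant counterpart of `x (t + 1)`: the same rate `η t`, but with the reward `u (t +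
  -- 1)` included. The two slopes differ by `η t • u (t + 1)` only.
  choose x' hx' using fun t : ℕ => hmin (η t • ∑ τ ∈ Finset.Icc 1 (t + 1), u τ)
  refine ⟨fun τ => u τ (x' (τ - 1) - x τ), fun τ hτ => ?_, fun t => ?_⟩
  · obtain ⟨k, rfl⟩ := Nat.exists_eq_add_of_le' hτ
    have h1 : ‖x' k - x (k + 1)‖ₑ ≤ _ := enorm_sub_le_gammaTildeInv hgr (v := u (k + 1))
      (hη k).le (hx k) (by
        have := hx' k
        rwa [Finset.sum_Icc_succ_top (by omega), smul_add] at this)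
    refine le_trans ?_ (mul_le_mul_right h1 _)
    simp only [Nat.add_sub_cancel]
    rw [← ofReal_norm, ← ofReal_norm, ← ENNReal.ofReal_mul (norm_nonneg _)]
    exact ENNReal.ofReal_le_ofReal ((le_abs_self _).trans ((u (k + 1)).le_opNorm _))
  · have key : ∀ y ∈ effDom h, (∑ τ ∈ Finset.Icc 1 t, u τ) y -
        ((h y).toReal - (h x₀).toReal) / η t ≤
          ∑ τ ∈ Finset.Icc 1 t, (u τ (x τ) + u τ (x' (τ - 1) - x τ)) := by
      induction t with
      | zero =>
        intro y hy
        have h1 := hx₀.2 y hy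
        have h2 : 0 ≤ ((h y).toReal - (h x₀).toReal) / η 0 :=
          div_nonneg (by simpa using h1) (hη 0).le
        simpa using h2
      | succ t ih =>
        -- Optimality of `x' t` replaces `y` by `x' t`, to which the induction hypothesis applies;
        -- passing from `η t` to the smaller `η (t + 1)` only enlarges the penalty, because `h y ≥ h
        -- x₀`.
        intro y hy
        have h0 : 0 ≤ (h y).toReal - (h x₀).toReal := by simpa using hx₀.2 y hy
        have h1 : ((h y).toReal - (h x₀).toReal) / η t ≤
            ((h y).toReal - (h x₀).toReal) / η (t + 1) :=
          div_le_div_of_nonneg_left h0 (hη _) (hηanti t)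
        have h2 := (hx' t).2 y hy
        have h3 := ih (x' t) (hx' t).1
        set U := ∑ τ ∈ Finset.Icc 1 (t + 1), u τ with hU
        have h4 : U y - ((h y).toReal - (h x₀).toReal) / η t ≤
            U (x' t) - ((h (x' t)).toReal - (h x₀).toReal) / η t := by
          simp only [smul_apply, smul_eq_mul, map_sub] at h2
          have h5 : U y - U (x' t) ≤ ((h y).toReal - (h (x' t)).toReal) / η t := by
            rw [le_div_iff₀ (hη t)]; linarith
          have h6 : ((h y).toReal - (h x₀).toReal) / η t =
              ((h y).toReal - (h (x' t)).toReal) / η t +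
                ((h (x' t)).toReal - (h x₀).toReal) / η t := by ring
          linarith
        have h7 : U (x' t) = (∑ τ ∈ Finset.Icc 1 t, u τ) (x' t) + u (t + 1) (x' t) := by
          rw [hU, Finset.sum_Icc_succ_top (by omega), add_apply]
        rw [Finset.sum_Icc_succ_top (by omega)]
        simp only [Nat.add_sub_cancel, map_sub] at h3 ⊢
        linarith
    intro y hy
    have h1 := key y hy
    rw [Finset.sum_add_distrib, sum_apply] at h1
    rw [regret]
    linarith

/-- Regularizers satisfying the qualification condition `HasPerturbations` have minimizers after
any linear perturbation, with uniform growth. -/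
theorem IsUnifRegularizer.minimizers [CompleteSpace X] {C : Set X} (hh : IsUnifRegularizer h C γ)
    {M R r : ℝ} (hr : 0 < r) (hQ : HasPerturbations C (fun x => (h x).toReal) M R r) :
    (∀ ξ : StrongDual ℝ X, ∃ x, IsMinimizer h ξ x) ∧
    ∀ (ξ : StrongDual ℝ X) (x : X), IsMinimizer h ξ x → ∀ y ∈ effDom h,
      γ ‖y - x‖₊ ≤ ENNReal.ofReal ((h y).toReal - (h x).toReal - ξ (y - x)) := by
  obtain ⟨⟨hess, hγ, hgr⟩, rfl⟩ := hh
  have hp := hess.proper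
  have hconv := hp.convexOn_toReal hess.convex
  have hl := hp.isSeqLscOn_toReal hess.lsc
  have huc := (hp.hasUnifGrowth_toReal hgr).isUnifConvexOn hγ.lsc hconv hl hr hQ
  refine ⟨fun ξ => ?_, fun ξ x hx y hy => huc.growth hγ hconv hx.1 hx.2 hy⟩
  obtain ⟨x, hx, hmin⟩ := huc.exists_minimizer hγ hconv hl hp.2 ξ
  exact ⟨x, hx, hmin⟩

end Regret

/-! ### Rewards as functionals, integrated against densities -/

section Rewards

variable {S : Type*} [MeasurableSpace S] {μ : Measure S} {p q : ℝ≥0∞}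


theorem integrable_reward_mul [ENNReal.HolderConjugate q p] {u : S → ℝ} (hu : MemLp u q μ) (x : Lp ℝ p μ) :
    Integrable (fun s => u s * x s) μ :=
  hu.integrable_mul (Lp.memLp x)

theorem integral_mul_le_of_mem_densities {x : Lp ℝ p μ} (hx : x ∈ densities μ p) {f : S → ℝ}
    (hf : Integrable (fun s => f s * x s) μ) {a : ℝ} (ha : ∀ᵐ s ∂μ, x s ≠ 0 → f s ≤ a) :
    ∫ s, f s * x s ∂μ ≤ a := by
  have hx' := mem_densities_iff.1 hx
  calc ∫ s, f s * x s ∂μ ≤ ∫ s, a * x s ∂μ := by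
        refine integral_mono_ae hf (hx'.2.1.const_mul a) ?_
        filter_upwards [ha, hx'.1] with s h1 h2
        rcases eq_or_ne (x s) 0 with h0 | h0
        · simp [h0]
        · exact mul_le_mul_of_nonneg_right (h1 h0) h2
    _ = a := by rw [integral_const_mul, hx'.2.2, mul_one]

theorem le_integral_mul_of_mem_densities {x : Lp ℝ p μ} (hx : x ∈ densities μ p) {f : S → ℝ}
    (hf : Integrable (fun s => f s * x s) μ) {a : ℝ} (ha : ∀ᵐ s ∂μ, x s ≠ 0 → a ≤ f s) :
    a ≤ ∫ s, f s * x s ∂μ := by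
  have := integral_mul_le_of_mem_densities hx (f := fun s => -f s) (a := -a)
    (hf.neg.congr (Eventually.of_forall fun s => (neg_mul _ _).symm))
    (ha.mono fun s hs h0 => neg_le_neg (hs h0))
  simp only [neg_mul, integral_neg] at this
  linarith

variable [Fact (1 ≤ p)] [Fact (1 ≤ q)] [ENNReal.HolderConjugate q p]

theorem rewardFunctional_apply {u : S → ℝ} (hu : MemLp u q μ) (x : Lp ℝ p μ) :
    rewardFunctional u hu x = ∫ s, u s * x s ∂μ := by
  rw [rewardFunctional, ContinuousLinearMap.lpPairing_eq_integral]
  refine integral_congr_ae ?_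
  filter_upwards [hu.coeFn_toLp] with s hs
  rw [hs, ContinuousLinearMap.mul_apply']

theorem sum_rewardFunctional_apply {u : ℕ → S → ℝ} (hu : ∀ t, MemLp (u t) q μ) (x : Lp ℝ p μ)
    (I : Finset ℕ) : ∑ τ ∈ I, rewardFunctional (u τ) (hu τ) x =
      ∫ s, (∑ τ ∈ I, u τ s) * x s ∂μ := by
  simp only [rewardFunctional_apply, Finset.sum_mul]
  rw [integral_finsetSum _ fun τ _ => integrable_reward_mul (hu τ) x]

end Rewards

theorem continuous_of_modulus {S : Type*} [PseudoMetricSpace S] {f : S → ℝ} {χ : ℝ≥0 → ℝ≥0∞}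
    (hχ : IsModulus χ) (hf : ∀ s s', ENNReal.ofReal |f s - f s'| ≤ χ (nndist s s')) :
    Continuous f := by
  rw [Metric.continuous_iff]
  intro b ε hε
  obtain ⟨δ, hδ, hball⟩ := Metric.eventually_nhds_iff.1
    (hχ.tendsto.eventually (gt_mem_nhds (ENNReal.ofReal_pos.2 hε)))
  refine ⟨δ, hδ, fun a ha => ?_⟩
  have h1 := hball (y := nndist a b) (by rwa [NNReal.dist_eq, NNReal.coe_zero, sub_zero,
    coe_nndist, abs_of_nonneg dist_nonneg])
  rw [Real.dist_eq]
  exact (ENNReal.ofReal_lt_ofReal_iff hε).1 ((hf a b).trans_lt h1)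

end DualAvg

/-! ### Regret of Dual Averaging on densities -/

theorem theorem3 {S : Type*} [MetricSpace S] [CompactSpace S] [MeasurableSpace S] [BorelSpace S]
    (μ : Measure S) (p q : ℝ≥0∞) [Fact (1 ≤ p)] [Fact (1 ≤ q)] [ENNReal.HolderConjugate q p]
    (hp : 1 < p) (hq : 1 < q)
    (u : ℕ → S → ℝ) (hu : ∀ t, MemLp (u t) q μ)
    (χ : ℝ≥0 → ℝ≥0∞) (hχ : DualAvg.IsModulus χ)
    (huχ : ∀ t, 1 ≤ t → ∀ s s' : S, ENNReal.ofReal |u t s - u t s'| ≤ χ (nndist s s'))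
    (h : Lp ℝ p μ → EReal) (γ : ℝ≥0 → ℝ≥0∞)
    (hh : DualAvg.IsUnifRegularizer h (DualAvg.densities μ p) γ)
    (η : ℕ → ℝ) (hη0 : η 0 = η 1) (hηpos : ∀ t, 1 ≤ t → 0 < η t)
    (hηanti : ∀ s t, 1 ≤ s → s ≤ t → η t ≤ η s) :
    (∃ x : ℕ → Lp ℝ p μ,
      DualAvg.IsDualAveraging h η (fun τ => DualAvg.rewardFunctional (u τ) (hu τ)) x) ∧
    ∀ x : ℕ → Lp ℝ p μ,
      DualAvg.IsDualAveraging h η (fun τ => DualAvg.rewardFunctional (u τ) (hu τ)) x →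
      ∀ ϑ : ℕ → ℝ≥0, (∀ t, 1 ≤ t → 0 < ϑ t) → ∀ t, 1 ≤ t →
        DualAvg.worstRegret (DualAvg.densities μ p)
            (fun τ => DualAvg.rewardFunctional (u τ) (hu τ)) x t ≤
          ((⨆ s : S, ⨅ y ∈ DualAvg.densitiesNear μ p s (ϑ t), h y) -
              ⨅ y ∈ DualAvg.densities μ p, h y) / ((η t : ℝ) : EReal) +
            ((((t : ℝ≥0∞) * χ (ϑ t) : ℝ≥0∞) : EReal)) +
            ((∑ τ ∈ Finset.Icc 1 t,
                ‖(DualAvg.rewardFunctional (u τ) (hu τ) : StrongDual ℝ (Lp ℝ p μ))‖ₑ *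
                  DualAvg.gammaTildeInv γ
                    (ENNReal.ofReal (η (τ - 1)) / 2 *
                      ‖(DualAvg.rewardFunctional (u τ) (hu τ) : StrongDual ℝ (Lp ℝ p μ))‖ₑ) :
                ℝ≥0∞) : EReal) := by
  have hp' := hh.1.ess.proper
  have hγ := hh.1.gammaU
  obtain ⟨M, R, r, hr, hQ⟩ := DualAvg.hasPerturbations_densities hp' hh.1.ess.lsc hh.2
  obtain ⟨hmin, hgr⟩ := hh.minimizers hr hQ
  have hgrad : ∀ ξ x, DualAvg.IsMinimizer h ξ x → DualAvg.IsFrechetGradient (DualAvg.conj h) ξ x :=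
    fun ξ x hx => hx.isFrechetGradient hp' hγ hmin (hgr ξ x hx)
  set U : ℕ → StrongDual ℝ (Lp ℝ p μ) := fun τ => DualAvg.rewardFunctional (u τ) (hu τ) with hU
  have hdens : ∀ y, y ∈ DualAvg.effDom h ↔ y ∈ DualAvg.densities μ p := fun y => by rw [hh.2]
  refine ⟨?_, fun x hx ϑ hϑ t ht => ?_⟩
  · choose z hz using fun t : ℕ => hmin (η t • ∑ τ ∈ Finset.Icc 1 t, U τ)
    exact ⟨fun t => z (t - 1), fun t => hgrad _ _ (hz t)⟩
  have hη : ∀ t, 0 < η t := by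
    rintro (_ | t)
    · rw [hη0]; exact hηpos 1 le_rfl
    · exact hηpos _ (by omega)
  have hanti : ∀ t, η (t + 1) ≤ η t := by
    rintro (_ | t)
    · rw [hη0]
    · exact hηanti _ _ (by omega) (by omega)
  have hxmin : ∀ t, DualAvg.IsMinimizer h (η t • ∑ τ ∈ Finset.Icc 1 t, U τ) (x (t + 1)) := by
    intro t
    obtain ⟨z, hz⟩ := hmin (η t • ∑ τ ∈ Finset.Icc 1 t, U τ)
    rwa [(hx t).eq (hgrad _ _ hz)]
  obtain ⟨x₀, hx₀⟩ := hmin 0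
  obtain ⟨g, hg, hreg⟩ := DualAvg.regret_le_of_isMinimizer hmin hgr hη hanti hxmin hx₀
  -- the minimum of the regularizer
  have hx₀le : ∀ y ∈ DualAvg.densities μ p, (h x₀).toReal ≤ (h y).toReal := fun y hy => by
    simpa using hx₀.2 y ((hdens y).2 hy)
  have hcoe : ∀ y ∈ DualAvg.densities μ p, ((h y).toReal : EReal) = h y := fun y hy =>
    hp'.coe_toReal ((hdens y).2 hy)
  have hinf : ⨅ y ∈ DualAvg.densities μ p, h y = ((h x₀).toReal : EReal) := by
    refine le_antisymm ?_ (le_iInf₂ fun y hy => ?_)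
    · rw [hp'.coe_toReal hx₀.1]; exact iInf₂_le x₀ ((hdens _).1 hx₀.1)
    · rw [← hcoe y hy]; exact_mod_cast hx₀le y hy
  rw [hinf]
  -- the sum of the stability terms
  set E : ℝ≥0∞ := ∑ τ ∈ Finset.Icc 1 t,
    ‖U τ‖ₑ * DualAvg.gammaTildeInv γ (ENNReal.ofReal (η (τ - 1)) / 2 * ‖U τ‖ₑ) with hE
  have hgE : ENNReal.ofReal (∑ τ ∈ Finset.Icc 1 t, g τ) ≤ E := by
    -- The terms `g τ` may be negative, so they are cut off at `0` before `ENNReal.ofReal` is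
    -- distributed over the sum.
    refine (ENNReal.ofReal_le_ofReal (Finset.sum_le_sum fun τ _ => le_max_left (g τ) 0)).trans ?_
    rw [ENNReal.ofReal_sum_of_nonneg fun τ _ => le_max_right _ _]
    refine Finset.sum_le_sum fun τ hτ => ?_
    refine le_trans (le_of_eq ?_) (hg τ (Finset.mem_Icc.1 hτ).1)
    rw [ENNReal.ofReal_max, ENNReal.ofReal_zero, max_eq_left (zero_le)]
  refine iSup₂_le fun y hy => ?_
  -- the best location
  have hcont : Continuous fun s => ∑ τ ∈ Finset.Icc 1 t, u τ s :=
    continuous_finsetSum _ fun τ hτ =>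
      DualAvg.continuous_of_modulus hχ (huχ τ (Finset.mem_Icc.1 hτ).1)
  have : Nonempty S := by
    by_contra hempty
    rw [not_nonempty_iff] at hempty
    have := (DualAvg.mem_densities_iff.1 hy).2.2
    rw [integral_of_isEmpty] at this
    exact zero_ne_one this
  obtain ⟨s₀, -, hmax⟩ := isCompact_univ.exists_isMaxOn Set.univ_nonempty hcont.continuousOn
  have hs₀ : ∀ s, ∑ τ ∈ Finset.Icc 1 t, u τ s ≤ ∑ τ ∈ Finset.Icc 1 t, u τ s₀ :=
    fun s => hmax (Set.mem_univ s)
  set I := ⨅ z ∈ DualAvg.densitiesNear μ p s₀ (ϑ t), h z with hI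
  have hIle : I ≤ ⨆ s : S, ⨅ z ∈ DualAvg.densitiesNear μ p s (ϑ t), h z :=
    le_iSup (fun s : S => ⨅ z ∈ DualAvg.densitiesNear μ p s (ϑ t), h z) s₀
  have hIge : ((h x₀).toReal : EReal) ≤ I :=
    le_iInf₂ fun z hz => by rw [← hcoe z hz.1]; exact_mod_cast hx₀le z hz.1
  have hηt : (0 : EReal) < ((η t : ℝ) : EReal) := by exact_mod_cast hη t
  suffices hmain : ((DualAvg.regret U x t y : ℝ) : EReal) ≤
      (I - ((h x₀).toReal : EReal)) / ((η t : ℝ) : EReal) +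
        (((t : ℝ≥0∞) * χ (ϑ t) : ℝ≥0∞) : EReal) + (E : EReal) by
    refine hmain.trans ?_
    gcongr
    exact EReal.sub_le_sub hIle le_rfl
  induction hIr : I with
  | bot => rw [hIr] at hIge; exact absurd hIge (by simp)
  -- No density is supported near `s₀`: the right side is `⊤`, the other terms never being `⊥`.
  | top =>
    rw [EReal.top_sub_coe, EReal.top_div_of_pos_ne_top hηt (EReal.coe_ne_top _),
      EReal.top_add_of_ne_bot (EReal.coe_ennreal_ne_bot _),
      EReal.top_add_of_ne_bot (EReal.coe_ennreal_ne_bot _)]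
    exact le_top
  | coe i =>
    have e1 : ((i : EReal) - ((h x₀).toReal : EReal)) / ((η t : ℝ) : EReal) =
        (((i - (h x₀).toReal) / η t : ℝ) : EReal) := by
      rw [← EReal.coe_sub, ← EReal.coe_div]
    rw [e1]
    rcases eq_or_ne E ⊤ with hEt | hEt
    · rw [hEt, EReal.coe_ennreal_top, EReal.add_top_of_ne_bot]
      · exact le_top
      · exact (EReal.add_ne_bot_iff.2 ⟨EReal.coe_ne_bot _, EReal.coe_ennreal_ne_bot _⟩)
    rcases eq_or_ne (χ (ϑ t)) ⊤ with hχt | hχt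
    · have : (t : ℝ≥0∞) * χ (ϑ t) = ⊤ := by
        rw [hχt, ENNReal.mul_top (by exact_mod_cast (by omega : t ≠ 0))]
      rw [this, EReal.coe_ennreal_top, EReal.coe_add_top,
        EReal.top_add_of_ne_bot (EReal.coe_ennreal_ne_bot _)]
      exact le_top
    lift E to ℝ≥0 using hEt with E' hE'
    lift χ (ϑ t) to ℝ≥0 using hχt with c hc
    have e2 : (t : ℝ≥0∞) * (c : ℝ≥0∞) = ((t * c : ℝ≥0) : ℝ≥0∞) := by push_cast; rfl
    rw [e2, EReal.coe_nnreal_eq_coe_real, EReal.coe_nnreal_eq_coe_real, ← EReal.coe_add,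
      ← EReal.coe_add, EReal.coe_le_coe_iff]
    have hgE' : ∑ τ ∈ Finset.Icc 1 t, g τ ≤ E' := by
      rw [← ENNReal.ofReal_coe_nnreal] at hgE
      exact (ENNReal.ofReal_le_ofReal_iff E'.2).1 hgE
    refine le_of_forall_pos_le_add fun ε hε => ?_
    -- a nearly optimal density close to the best location
    obtain ⟨z, hz, hzi⟩ : ∃ z ∈ DualAvg.densitiesNear μ p s₀ (ϑ t), (h z).toReal < i + η t * ε := by
      have hlt : I < ((i + η t * ε : ℝ) : EReal) := by
        rw [hIr]; exact_mod_cast lt_add_of_pos_right i (mul_pos (hη t) hε)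
      simp only [hI, iInf_lt_iff] at hlt
      obtain ⟨z, hz, hlt⟩ := hlt
      rw [← hcoe z hz.1] at hlt
      exact ⟨z, hz, by exact_mod_cast hlt⟩
    have hy1 : ∑ τ ∈ Finset.Icc 1 t, U τ y ≤ ∑ τ ∈ Finset.Icc 1 t, u τ s₀ := by
      simp only [hU]
      rw [DualAvg.sum_rewardFunctional_apply]
      refine DualAvg.integral_mul_le_of_mem_densities hy ?_ (ae_of_all _ fun s _ => hs₀ s)
      simp only [Finset.sum_mul]
      exact integrable_finsetSum _ fun τ _ => DualAvg.integrable_reward_mul (hu τ) y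
    have hz1 : ∀ τ ∈ Finset.Icc 1 t, u τ s₀ - c ≤ U τ z := by
      intro τ hτ
      simp only [hU]
      rw [DualAvg.rewardFunctional_apply]
      refine DualAvg.le_integral_mul_of_mem_densities hz.1
        (DualAvg.integrable_reward_mul (hu τ) z) ?_
      filter_upwards [hz.2] with s hs hne
      have hball : s ∈ Metric.ball s₀ (ϑ t) := by
        by_contra hcon
        exact hne (hs hcon)
      have h1 := (huχ τ (Finset.mem_Icc.1 hτ).1 s₀ s).trans (hχ.mono (b := ϑ t) (by
        rw [← NNReal.coe_le_coe, coe_nndist, dist_comm]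
        exact (Metric.mem_ball.1 hball).le))
      rw [← hc, ← ENNReal.ofReal_coe_nnreal] at h1
      have h2 : u τ s₀ - u τ s ≤ c := (le_abs_self _).trans ((ENNReal.ofReal_le_ofReal_iff c.2).1 h1)
      linarith
    have hz2 := Finset.sum_le_sum hz1
    rw [Finset.sum_sub_distrib, Finset.sum_const, Nat.card_Icc, nsmul_eq_mul] at hz2
    have hzr := hreg t z ((hdens z).2 hz.1)
    -- The slack `η t * ε` in the choice of `z` becomes `ε` after division by `η t`.
    have h3 : ((h z).toReal - (h x₀).toReal) / η t ≤ (i - (h x₀).toReal) / η t + ε := by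
      rw [div_add' _ _ _ (hη t).ne']
      exact div_le_div_of_nonneg_right (by linarith) (hη t).le
    -- Rewards of `y` total at most those at `s₀`, and those of `z` fall short of that by at most `t
    -- * c`, so the regret against `y` exceeds the one against `z` by at most `t * c`.
    simp only [DualAvg.regret] at hzr ⊢
    push_cast
    simp only [Nat.add_sub_cancel] at hz2
    linarith
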